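/- **Setting.** Let $N\ge 0$, let $G\subset O(N,\mathbb R)$ be a finite group generated by reflections, and let $R=\{\alpha\in\mathbb R^N:\langle\alpha,\alpha\rangle=2,\ \sigma_\alpha\in G\}$ be its normalized root system, where $\sigma_\alpha$ is the reflection in the hyperplane orthogonal to $\alpha$. Let $R_+$ be a positive subsystem of $R$ and $k:R\to[0,\infty)$ a $G$-invariant function. The Dunkl operators are $$T_if(x)=\partial_if(x)+\sum_{\alpha\in R_+}k(\alpha)\,\alpha_i\,\frac{f(x)-f(\sigma_\alpha x)}{\langle\alpha,x\rangle}\qquad(1\le i\le N),$$ the quotient being read as its limit $\partial_\alpha f(x)$ where $\langle\alpha,x\rangle=0$; put $\Delta_k=\sum_{i=1}^N T_i^2$. On the algebra $\mathcal P=\mathbb C[\mathbb R^N]$ of polynomials let $[p,q]_k=(p(T)q)(0)$, where $p(T)=\sum_\nu a_\nu T_1^{\nu_1}\cdots T_N^{\nu_N}$ for $p=\sum_\nu a_\nu x^\nu$. Let $\{\varphi_\nu\}_{\nu\in\mathbb Z_+^N}$ be a basis of $\mathcal P$ with $[\varphi_\nu,\varphi_\mu]_k=\delta_{\nu,\mu}$,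 such that $\varphi_\nu$ is homogeneous of degree $|\nu|$ and has real coefficients. The associated generalized Hermite polynomials are $$H_\nu=2^{|\nu|}e^{-\Delta_k/4}\varphi_\nu=2^{|\nu|}\sum_{n=0}^{\lfloor|\nu|/2\rfloor}\frac{(-1)^n}{4^n\,n!}\,\Delta_k^n\varphi_\nu .$$ Let $K$ be the generalized exponential kernel of $G$ and $k$, that is, the unique holomorphic function on $\mathbb C^N\times\mathbb C^N$ such that for every $y\in\mathbb R^N$ the function $f=K(\cdot,y)$ satisfies $T_if=y_if$ on $\mathbb R^N$ for $i=1,\dots,N$, and $f(0)=1$ (existence and uniqueness of $K$ are part of the statement). Put $l(w)=\sum_{i=1}^N w_i^2$ for $w\in\mathbb C^N$. **Proposition 3.8.** For $n\in\mathbb Z_+$ and $z,w\in\mathbb C^N$ put $L_n(z,w)=\sum_{|\nu|=n}H_\nu(z)\,\varphi_\nu(w)$. Then $$\sum_{n=0}^\infty L_n(z,w)=e^{-l(w)}\,K(2z,w)\qquad\text{for all }z,w\in\mathbb C^N,$$ and the series converges normally on $\mathbb C^N\times\mathbb C^N$: on every compact subset the functions $|L_n|$ are bounded by constants $M_n$ with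 $\sum_n M_n<\infty$. -/

import Mathlib

noncomputable section

namespace Dunkl

/-- The Euclidean space `ℝ^N`. -/
abbrev V (N : ℕ) : Type := EuclideanSpace ℝ (Fin N)

/-- The algebra `ℂ[ℝ^N]` of polynomial functions on `ℝ^N` with complex coefficients. Its elements
also act as polynomial functions on `ℂ^N`. -/
abbrev Poly (N : ℕ) : Type := MvPolynomial (Fin N) ℂ

variable {N : ℕ}

/-! ### Finite reflection groups, roots, multiplicity functions -/

/-- The orthogonal reflection of `ℝ^N` in the hyperplane orthogonal to `α`. -/
abbrev refl (α : V N) : V N ≃ₗᵢ[ℝ] V N :=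
  (Submodule.span ℝ {α})ᗮ.reflection

/-- A finite subgroup of `O(N)` generated by the reflections it contains. -/
def IsFiniteReflectionGroup (G : Subgroup (V N ≃ₗᵢ[ℝ] V N)) : Prop :=
  Finite G ∧ Subgroup.closure {g | g ∈ G ∧ ∃ α : V N, α ≠ 0 ∧ g = refl α} = G

/-- The root system of the reflections of `G`, normalized by `⟨α, α⟩ = 2`. -/
def roots (G : Subgroup (V N ≃ₗᵢ[ℝ] V N)) : Set (V N) :=
  {α | inner ℝ α α = 2 ∧ refl α ∈ G}

/-- `Rp` is a positive subsystem of the roots of `G`: the roots on one side of a hyperplane that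
contains no root. -/
def IsPositiveSubsystem (G : Subgroup (V N ≃ₗᵢ[ℝ] V N)) (Rp : Finset (V N)) : Prop :=
  ∃ v : V N, (∀ α ∈ roots G, inner ℝ α v ≠ 0) ∧
    ∀ α, α ∈ Rp ↔ α ∈ roots G ∧ 0 < inner ℝ α v

/-- `k` is a `G`-invariant, non-negative function on the roots of `G`
(values away from the roots are irrelevant). -/
def IsMultiplicity (G : Subgroup (V N ≃ₗᵢ[ℝ] V N)) (k : V N → ℝ) : Prop :=
  (∀ g ∈ G, ∀ α ∈ roots G, k (g α) = k α) ∧ ∀ α ∈ roots G, 0 ≤ k α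

/-! ### Dunkl operators on functions -/

/-- The Dunkl operator
`T_i f (x) = ∂_i f (x) + ∑_{α ∈ R_+} k(α) α_i (f x - f (σ_α x)) / ⟨α, x⟩` on (continuously)
differentiable functions on `ℝ^N`. On the hyperplane `⟨α, x⟩ = 0` the quotient is read as its
limit, which for `⟨α, α⟩ = 2` is the derivative of `f` at `x` in direction `α`. -/
def dunklOp (Rp : Finset (V N)) (k : V N → ℝ) (i : Fin N) (f : V N → ℂ) (x : V N) : ℂ :=
  fderiv ℝ f x (EuclideanSpace.single i 1) +
    ∑ α ∈ Rp, ((k α * α i : ℝ) : ℂ) *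
      (if inner ℝ α x = 0 then fderiv ℝ f x α
        else (f x - f (refl α x)) / ((inner ℝ α x : ℝ) : ℂ))

/-! ### Dunkl operators on polynomials -/

/-- The linear form `x ↦ ⟨α, x⟩` as a polynomial. -/
def linForm (α : V N) : Poly N :=
  ∑ i, MvPolynomial.C ((α i : ℝ) : ℂ) * MvPolynomial.X i

/-- The polynomial `x ↦ p (σ_α x)`, where `σ_α x = x - 2 ⟨α, x⟩ / |α|² • α`. -/
def reflPoly (α : V N) : Poly N →ₐ[ℂ] Poly N :=
  MvPolynomial.aeval fun i =>
    MvPolynomial.X i - MvPolynomial.C ((2 / ‖α‖ ^ 2 * α i : ℝ) : ℂ) * linForm α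

theorem linForm_dvd (α : V N) (p : Poly N) : linForm α ∣ p - reflPoly α p := by
  rw [← Ideal.mem_span_singleton, ← Ideal.Quotient.mk_eq_mk_iff_sub_mem]
  have h : (Ideal.Quotient.mkₐ ℂ (Ideal.span {linForm α})) =
      (Ideal.Quotient.mkₐ ℂ (Ideal.span {linForm α})).comp (reflPoly α) := by
    apply MvPolynomial.algHom_ext
    intro i
    simp only [AlgHom.comp_apply, reflPoly, MvPolynomial.aeval_X, Ideal.Quotient.mkₐ_eq_mk]
    rw [Ideal.Quotient.mk_eq_mk_iff_sub_mem, Ideal.mem_span_singleton]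
    simp
  exact DFunLike.congr_fun h p

open Classical in
/-- The polynomial `(p - p ∘ σ_α) / ⟨α, ·⟩`, i.e. the unique `q` with
`p - p ∘ σ_α = ⟨α, ·⟩ q`, as a linear operator in `p` (and `0` in the irrelevant case `α = 0`). -/
def dividedDifference (α : V N) : Module.End ℂ (Poly N) :=
  if h : linForm α = 0 then 0 else
    { toFun := fun p => (linForm_dvd α p).choose
      map_add' := fun p q => by
        apply mul_left_cancel₀ h
        rw [mul_add, ← (linForm_dvd α p).choose_spec, ← (linForm_dvd α q).choose_spec,
          ← (linForm_dvd α (p + q)).choose_spec, map_add]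
        ring
      map_smul' := fun c p => by
        apply mul_left_cancel₀ h
        rw [RingHom.id_apply, mul_smul_comm, ← (linForm_dvd α p).choose_spec,
          ← (linForm_dvd α (c • p)).choose_spec, map_smul, smul_sub] }

/-- The Dunkl operator `T_i` on polynomials. -/
def dunklPoly (Rp : Finset (V N)) (k : V N → ℝ) (i : Fin N) : Module.End ℂ (Poly N) :=
  (MvPolynomial.pderiv i : Derivation ℂ (Poly N) (Poly N)).toLinearMap +
    ∑ α ∈ Rp, ((k α * α i : ℝ) : ℂ) • dividedDifference α

/-- The operator `p(T) = ∑_ν a_ν T_1^{ν_1} ⋯ T_N^{ν_N}` for `p = ∑_ν a_ν x^ν`. -/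
def polyOp (Rp : Finset (V N)) (k : V N → ℝ) (p : Poly N) : Module.End ℂ (Poly N) :=
  p.support.sum fun ν =>
    MvPolynomial.coeff ν p • (List.ofFn fun i => dunklPoly Rp k i ^ ν i).prod

/-- The bilinear form `[p, q]_k = (p(T) q)(0)`. -/
def pairing (Rp : Finset (V N)) (k : V N → ℝ) (p q : Poly N) : ℂ :=
  MvPolynomial.eval 0 (polyOp Rp k p q)

/-- The generalized Laplacian `Δ_k = ∑ T_i²`. -/
def laplacian (Rp : Finset (V N)) (k : V N → ℝ) : Module.End ℂ (Poly N) :=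
  ∑ i, dunklPoly Rp k i ^ 2

/-! ### Orthonormal bases and generalized Hermite polynomials -/

/-- `φ` is a basis of the polynomials indexed by multi-indices, orthonormal for `[·,·]_k`, with
`φ_ν` homogeneous of degree `|ν|` and with real coefficients. -/
def IsOrthonormalBasis (Rp : Finset (V N)) (k : V N → ℝ)
    (φ : Module.Basis (Fin N →₀ ℕ) ℂ (Poly N)) : Prop :=
  (∀ ν μ, pairing Rp k (φ ν) (φ μ) = if ν = μ then 1 else 0) ∧
    (∀ ν, (φ ν).IsHomogeneous ν.degree) ∧
    ∀ ν μ, (MvPolynomial.coeff μ (φ ν)).im = 0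

/-- The generalized Hermite polynomial `H_ν = 2^|ν| e^{-Δ_k/4} φ_ν`; the exponential series stops
at `⌊|ν|/2⌋` because `Δ_k` lowers the degree by two. -/
def hermite (Rp : Finset (V N)) (k : V N → ℝ) (φ : Module.Basis (Fin N →₀ ℕ) ℂ (Poly N))
    (ν : Fin N →₀ ℕ) : Poly N :=
  (2 : ℂ) ^ ν.degree • ∑ n ∈ Finset.range (ν.degree / 2 + 1),
    ((-1 : ℂ) ^ n / (4 ^ n * (n.factorial : ℂ))) • (laplacian Rp k ^ n) (φ ν)

/-- `L_n(z, w) = ∑_{|ν| = n} H_ν(z) φ_ν(w)`. -/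
def hermiteSum (Rp : Finset (V N)) (k : V N → ℝ) (φ : Module.Basis (Fin N →₀ ℕ) ℂ (Poly N))
    (n : ℕ) (z w : Fin N → ℂ) : ℂ :=
  ∑ ν ∈ Finset.finsuppAntidiag (Finset.univ : Finset (Fin N)) n,
    MvPolynomial.eval z (hermite Rp k φ ν) * MvPolynomial.eval w (φ ν)

/-! ### The generalized exponential kernel -/

/-- The inclusion of `ℝ^N` in `ℂ^N`. -/
def toC (x : V N) : Fin N → ℂ := fun i => ((x i : ℝ) : ℂ)

/-- `K` is holomorphic on `ℂ^N × ℂ^N` and, for every `y ∈ ℝ^N`, the function `f = K(·, y)` on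
`ℝ^N` solves `T_i f = y_i f` (`i = 1, …, N`) and `f(0) = 1`. -/
def IsDunklKernel (Rp : Finset (V N)) (k : V N → ℝ)
    (K : (Fin N → ℂ) → (Fin N → ℂ) → ℂ) : Prop :=
  Differentiable ℂ (fun p : (Fin N → ℂ) × (Fin N → ℂ) => K p.1 p.2) ∧
    ∀ y : V N, K 0 (toC y) = 1 ∧
      ∀ (i : Fin N) (x : V N),
        dunklOp Rp k i (fun x' => K (toC x') (toC y)) x = ((y i : ℝ) : ℂ) * K (toC x) (toC y)

/-- The generalized exponential kernel on `ℂ^N × ℂ^N`, characterized by `IsDunklKernel`. -/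
def dunklKernel (Rp : Finset (V N)) (k : V N → ℝ) : (Fin N → ℂ) → (Fin N → ℂ) → ℂ :=
  Classical.epsilon (IsDunklKernel Rp k)

/-! ### Normal convergence -/

/-- The series `∑ F n` of functions converges normally: on every compact set it is dominated by a
convergent series of constants (equivalently, the suprema of `‖F n‖` there are summable). -/
def ConvergesNormally {X : Type*} [TopologicalSpace X] (F : ℕ → X → ℂ) : Prop :=
  ∀ S : Set X, IsCompact S → ∃ M : ℕ → ℝ, Summable M ∧ ∀ n, ∀ x ∈ S, ‖F n x‖ ≤ M n

end Dunkl

end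

/-!
The homogeneous polynomials `K_n(z, w) = ∑_{|ν| = n} φ_ν(z) φ_ν(w)` are the reproducing kernels of
the pairing `[·, ·]_k`. The Dunkl operators commute (`IsRootData.dunklPoly_comm`), so that
multiplication by `x_i` is adjoint to `T_i`, and it follows that
`T_i K_n(·, w) = w_i K_{n-1}(·, w)` and `K_0 = 1` (`IsRootData.dunklPoly_kerPoly`,
`IsOrthonormalBasis.kerPoly_zero`). In other words, the `K_n` are the homogeneous
parts of a joint eigenfunction of the Dunkl operators.

Convergence rests on the Euler identity `∑ x_i T_i = E + ∑ k(α) (1 - σ_α)`, `E = ∑ x_i ∂_i`.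
Applied to `K_n(·, w)` at a maximum of its modulus over a ball, it gives
`|K_n(z, w)| ≤ (|z| |w|)^n / n!`, up to the choice of norms (`IsRootData.norm_eval_kerPoly_le`);
this is where `k ≥ 0` enters.
Hence `K = ∑ K_n` is entire and may be differentiated term by term, so it is a generalized
exponential kernel (`IsRootData.isDunklKernel_kerSum`). The same maximum argument, for the radial
derivative of the difference of two kernels on `ℝ^N`, shows that the kernel is unique
(`IsRootData.eq_zero_of_dunklOp_eq`); the identity theorem extends this to `ℂ^N`.

Finally `Δ_k K_n(·, w) = l(w) K_{n-2}(·, w)`. Applying `2^n exp (-Δ_k / 4)` to `K_n(·, w)` yields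
`L_n(z, w) = ∑_{2j + m = n} (-l(w))^j / j! · K_m(2z, w)`, which is the `n`-th term of the Cauchy
product of the series of `exp (-l(w))` and of `K(2z, w)` (`IsRootData.hermiteSum_eq`). Both series
are dominated on compact sets by convergent series of constants, and so is their Cauchy product.
-/

noncomputable section

namespace Dunkl

open MvPolynomial

variable {N : ℕ} {Rp : Finset (V N)} {k : V N → ℝ}
  {φ : Module.Basis (Fin N →₀ ℕ) ℂ (Poly N)}

/-! ### Root reflections -/

/-- The properties of a positive system `Rp` and of a multiplicity function `k` on which the theory
of Dunkl operators rests: the roots are normalized, a reflection in a root permutes the roots up to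
sign and preserves `k`, and `k` is non-negative. The second clause also says that exactly one of the
two opposite roots is positive. -/
structure IsRootData (Rp : Finset (V N)) (k : V N → ℝ) : Prop where
  inner_self : ∀ α ∈ Rp, inner ℝ α α = 2
  refl_mem : ∀ β ∈ Rp, ∀ α ∈ Rp,
    (refl β α ∈ Rp ∧ -refl β α ∉ Rp ∧ k (refl β α) = k α) ∨
      (refl β α ∉ Rp ∧ -refl β α ∈ Rp ∧ k (-refl β α) = k α)
  nonneg : ∀ α ∈ Rp, 0 ≤ k α

theorem refl_apply {α : V N} (hα : inner ℝ α α = 2) (x : V N) :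
    refl α x = x - (inner ℝ α x : ℝ) • α := by
  have h2 : ‖α‖ ^ 2 = 2 := by rw [← real_inner_self_eq_norm_sq, hα]
  rw [refl, Submodule.reflection_orthogonal_apply, Submodule.reflection_singleton_apply]
  simp [h2]
  module

theorem refl_refl (α x : V N) : refl α (refl α x) = x :=
  Submodule.reflection_reflection _ _

theorem refl_neg (α : V N) : refl (-α) = refl α := by
  have : Submodule.span ℝ {-α} = Submodule.span ℝ {α} := by
    rw [← Set.neg_singleton, Submodule.span_neg]
  simp only [refl, this]

theorem refl_refl_apply {α β : V N} (hα : inner ℝ α α = 2) (hβ : inner ℝ β β = 2) :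
    refl (refl β α) = refl β * refl α * refl β := by
  have h : inner ℝ (refl β α) (refl β α) = 2 := by rwa [LinearIsometryEquiv.inner_map_map]
  ext1 x
  change refl (refl β α) x = refl β (refl α (refl β x))
  rw [refl_apply h, refl_apply hα, refl_apply hβ x, refl_apply hβ α, refl_apply hβ]
  simp only [inner_sub_left, inner_sub_right, inner_smul_left, inner_smul_right, hβ,
    conj_trivial, real_inner_comm β α]
  module

/-- The reflection group normalizes its set of roots, so its positive subsystems together with an
invariant multiplicity function are root data. -/
theorem isRootData {G : Subgroup (V N ≃ₗᵢ[ℝ] V N)} {Rp : Finset (V N)}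
    (hRp : IsPositiveSubsystem G Rp) {k : V N → ℝ} (hk : IsMultiplicity G k) :
    IsRootData Rp k := by
  obtain ⟨v, hv, hRp⟩ := hRp
  have hneg : ∀ α ∈ roots G, -α ∈ roots G := fun α hα => by
    refine ⟨by simpa using hα.1, ?_⟩
    rw [refl_neg]
    exact hα.2
  have hrefl : ∀ β ∈ roots G, ∀ α ∈ roots G, refl β α ∈ roots G := fun β hβ α hα => by
    refine ⟨by rw [LinearIsometryEquiv.inner_map_map]; exact hα.1, ?_⟩
    rw [refl_refl_apply hα.1 hβ.1]
    exact G.mul_mem (G.mul_mem hβ.2 hα.2) hβ.2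
  refine ⟨fun α hα => ((hRp α).1 hα).1.1, fun β hβ α hα => ?_,
    fun α hα => hk.2 α ((hRp α).1 hα).1⟩
  have hβ' := ((hRp β).1 hβ).1
  have hα' := ((hRp α).1 hα).1
  have h1 := hrefl β hβ' α hα'
  have h2 := hneg _ h1
  have hk1 : k (refl β α) = k α := hk.1 _ hβ'.2 α hα'
  have hk2 : k (-refl β α) = k α := by
    rw [← hk1, ← hk.1 _ h1.2 _ h1]
    congr 1
    rw [refl_apply h1.1, h1.1]
    module
  rw [hRp, hRp]
  rcases lt_or_gt_of_ne (hv _ h1) with h | h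
  · exact Or.inr ⟨fun h' => absurd h'.2 h.not_gt, ⟨h2, by simpa [inner_neg_left] using h⟩, hk2⟩
  · exact Or.inl ⟨⟨h1, h⟩, fun h' => absurd h'.2 (by simpa [inner_neg_left] using h.le), hk1⟩

/-- A sum over the positive roots of a function which is even on the roots is not affected by a
root reflection, since the latter permutes the positive roots up to sign. The weight `k α` enters as
a separate argument, so that only its values on the positive roots matter. -/
theorem IsRootData.sum_refl {Rp : Finset (V N)} {k : V N → ℝ} (hR : IsRootData Rp k)
    {M : Type*} [AddCommMonoid M] (F : ℝ → V N → M) (hF : ∀ r, ∀ α ∈ Rp, F r (-α) = F r α)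
    {β : V N} (hβ : β ∈ Rp) :
    ∑ α ∈ Rp, F (k α) (refl β α) = ∑ α ∈ Rp, F (k α) α := by
  classical
  have key : ∀ α ∈ Rp, (if refl β α ∈ Rp then refl β α else -refl β α) ∈ Rp := fun α hα => by
    rcases hR.refl_mem β hβ α hα with h | h
    · rw [if_pos h.1]; exact h.1
    · rw [if_neg h.1]; exact h.2.1
  have hnn : ∀ α ∈ Rp, -α ∉ Rp := fun α hα h => by
    rcases hR.refl_mem α hα α hα with h' | h'
    all_goals
      rw [refl_apply (hR.inner_self α hα), hR.inner_self α hα,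
        show α - (2 : ℝ) • α = -α by module] at h'
    · exact h'.2.1 (by simpa using hα)
    · exact h'.1 h
  have inv : ∀ α ∈ Rp,
      (if refl β (if refl β α ∈ Rp then refl β α else -refl β α) ∈ Rp then
        refl β (if refl β α ∈ Rp then refl β α else -refl β α)
      else -refl β (if refl β α ∈ Rp then refl β α else -refl β α)) = α := fun α hα => by
    by_cases h : refl β α ∈ Rp
    · simp only [if_pos h, refl_refl, if_pos hα]
    · simp only [if_neg h, map_neg, refl_refl, if_neg (hnn α hα), neg_neg]
  refine Finset.sum_bij' (fun α _ => if refl β α ∈ Rp then refl β α else -refl β α)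
    (fun α _ => if refl β α ∈ Rp then refl β α else -refl β α) key key inv inv fun α hα => ?_
  rcases hR.refl_mem β hβ α hα with h | h
  · simp only [if_pos h.1, h.2.2]
  · simp only [if_neg h.1, h.2.2]
    have h' := hF (k α) _ h.2.1
    rwa [neg_neg] at h'

/-! ### Reflections and divided differences of polynomials -/

/-- The complexification `z ↦ z - ⟨α, z⟩ α` of the reflection in a root `α`, where `⟨α, α⟩ = 2`. -/
def cRefl (α : V N) (z : Fin N → ℂ) : Fin N → ℂ :=
  fun i => z i - (α i : ℂ) * eval z (linForm α)

theorem eval_linForm (α : V N) (z : Fin N → ℂ) :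
    eval z (linForm α) = ∑ i, (α i : ℂ) * z i := by
  simp [linForm]

theorem inner_eq_sum (x y : V N) : inner ℝ x y = ∑ i, x i * y i := by
  simp [PiLp.inner_apply, mul_comm]

theorem eval_toC_linForm (α x : V N) : eval (toC x) (linForm α) = ((inner ℝ α x : ℝ) : ℂ) := by
  simp [eval_linForm, inner_eq_sum, toC]

theorem reflPoly_X {α : V N} (hα : inner ℝ α α = 2) (i : Fin N) :
    reflPoly α (X i) = X i - C ((α i : ℝ) : ℂ) * linForm α := by
  have h2 : ‖α‖ ^ 2 = 2 := by rw [← real_inner_self_eq_norm_sq, hα]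
  simp [reflPoly, h2]

theorem eval_reflPoly {α : V N} (hα : inner ℝ α α = 2) (z : Fin N → ℂ) (p : Poly N) :
    eval z (reflPoly α p) = eval (cRefl α z) p := by
  induction p using MvPolynomial.induction_on with
  | C a => simp [← algebraMap_eq]
  | add p q hp hq => simp [hp, hq]
  | mul_X p i hp => simp [hp, reflPoly_X hα, cRefl]

theorem cRefl_toC {α : V N} (hα : inner ℝ α α = 2) (x : V N) :
    cRefl α (toC x) = toC (refl α x) := by
  ext i
  simp [cRefl, eval_toC_linForm, refl_apply hα, toC, mul_comm]

theorem linForm_neg (α : V N) : linForm (-α) = -linForm α := by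
  simp [linForm]

theorem linForm_ne_zero {α : V N} (hα : inner ℝ α α = 2) : linForm α ≠ 0 := by
  intro h
  have := eval_toC_linForm α α
  rw [h, hα] at this
  norm_num at this

theorem linForm_isHomogeneous (α : V N) : (linForm α).IsHomogeneous 1 :=
  IsHomogeneous.sum _ _ _ fun i _ => isHomogeneous_C_mul_X _ i

theorem linForm_mul_dividedDifference {α : V N} (hα : inner ℝ α α = 2) (p : Poly N) :
    linForm α * dividedDifference α p = p - reflPoly α p := by
  rw [dividedDifference, dif_neg (linForm_ne_zero hα)]
  exact (linForm_dvd α p).choose_spec.symm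

theorem reflPoly_neg (α : V N) : reflPoly (-α) = reflPoly α := by
  apply algHom_ext
  intro i
  simp [reflPoly, linForm_neg]

theorem dividedDifference_neg {α : V N} (hα : inner ℝ α α = 2) (p : Poly N) :
    dividedDifference (-α) p = -dividedDifference α p := by
  have hα' : inner ℝ (-α) (-α) = 2 := by simpa using hα
  apply mul_left_cancel₀ (linForm_ne_zero hα')
  rw [linForm_mul_dividedDifference hα', reflPoly_neg, linForm_neg, neg_mul_neg,
    linForm_mul_dividedDifference hα]

/-- The twisted Leibniz rule for divided differences. -/
theorem dividedDifference_X_mul {α : V N} (hα : inner ℝ α α = 2) (i : Fin N) (p : Poly N) :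
    dividedDifference α (X i * p) =
      X i * dividedDifference α p + C ((α i : ℝ) : ℂ) * reflPoly α p := by
  apply mul_left_cancel₀ (linForm_ne_zero hα)
  rw [linForm_mul_dividedDifference hα, map_mul, reflPoly_X hα, mul_add, mul_left_comm,
    linForm_mul_dividedDifference hα]
  ring

theorem dividedDifference_C {α : V N} (hα : inner ℝ α α = 2) (c : ℂ) :
    dividedDifference α (C c) = 0 := by
  apply mul_left_cancel₀ (linForm_ne_zero hα)
  rw [linForm_mul_dividedDifference hα]
  simp [← algebraMap_eq]

theorem reflPoly_isHomogeneous {α : V N} {p : Poly N} {n : ℕ} (hp : p.IsHomogeneous n) :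
    (reflPoly α p).IsHomogeneous n := by
  have h : ∀ i, (X i - C ((2 / ‖α‖ ^ 2 * α i : ℝ) : ℂ) * linForm α).IsHomogeneous 1 := fun i =>
    (isHomogeneous_X ℂ i).sub ((linForm_isHomogeneous α).C_mul _)
  have := hp.aeval _ h
  rw [one_mul] at this
  exact this

theorem isHomogeneous_of_linForm_mul {α : V N} (hα : inner ℝ α α = 2) {p : Poly N} {n : ℕ}
    (hp : (linForm α * p).IsHomogeneous (n + 1)) : p.IsHomogeneous n := by
  have key : ∀ m, homogeneousComponent (m + 1) (linForm α * p) =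
      linForm α * homogeneousComponent m p := fun m => by
    conv_lhs => rw [← sum_homogeneousComponent p, Finset.mul_sum, map_sum]
    have h : ∀ i, homogeneousComponent (m + 1) (linForm α * homogeneousComponent i p) =
        if i = m then linForm α * homogeneousComponent m p else 0 := fun i => by
      rw [homogeneousComponent_of_mem (n := 1 + i)
        ((linForm_isHomogeneous α).mul (homogeneousComponent_isHomogeneous i p))]
      by_cases h : i = m
      · subst h; simp [add_comm]
      · rw [if_neg h, if_neg (by omega)]
    simp only [h, Finset.sum_ite_eq', Finset.mem_range]
    split_ifs with h'
    · rfl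
    · rw [homogeneousComponent_eq_zero _ _ (by omega), mul_zero]
  have hz : linForm α * p = linForm α * homogeneousComponent n p := by
    rw [← key, homogeneousComponent_eq_self hp]
  rw [mul_left_cancel₀ (linForm_ne_zero hα) hz]
  exact homogeneousComponent_isHomogeneous n p

theorem dividedDifference_isHomogeneous {α : V N} (hα : inner ℝ α α = 2) {p : Poly N} {n : ℕ}
    (hp : p.IsHomogeneous (n + 1)) : (dividedDifference α p).IsHomogeneous n := by
  apply isHomogeneous_of_linForm_mul hα
  rw [linForm_mul_dividedDifference hα]
  exact hp.sub (reflPoly_isHomogeneous hp)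

/-! ### Equivariance of Dunkl operators -/

theorem eval_cRefl_linForm (α β : V N) (z : Fin N → ℂ) :
    eval (cRefl β z) (linForm α) =
      eval z (linForm α) - ((inner ℝ α β : ℝ) : ℂ) * eval z (linForm β) := by
  rw [eval_linForm, inner_eq_sum, eval_linForm α]
  simp only [cRefl, mul_sub, Finset.sum_sub_distrib, Complex.ofReal_sum, Finset.sum_mul,
    Complex.ofReal_mul, mul_assoc]

theorem eval_linForm_refl {α β : V N} (hβ : inner ℝ β β = 2) (z : Fin N → ℂ) :
    eval z (linForm (refl β α)) =
      eval z (linForm α) - ((inner ℝ α β : ℝ) : ℂ) * eval z (linForm β) := by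
  simp only [eval_linForm, refl_apply hβ, real_inner_comm, Finset.mul_sum,
    ← Finset.sum_sub_distrib]
  refine Finset.sum_congr rfl fun i _ => ?_
  simp
  ring

theorem reflPoly_linForm {α β : V N} (hβ : inner ℝ β β = 2) :
    reflPoly β (linForm α) = linForm (refl β α) := by
  refine MvPolynomial.funext fun z => ?_
  rw [eval_reflPoly hβ, eval_cRefl_linForm, eval_linForm_refl hβ]

theorem reflPoly_reflPoly {α β : V N} (hα : inner ℝ α α = 2) (hβ : inner ℝ β β = 2) (p : Poly N) :
    reflPoly β (reflPoly α p) = reflPoly (refl β α) (reflPoly β p) := by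
  have h : inner ℝ (refl β α) (refl β α) = 2 := by rwa [LinearIsometryEquiv.inner_map_map]
  refine MvPolynomial.funext fun z => ?_
  rw [eval_reflPoly hβ, eval_reflPoly hα, eval_reflPoly h, eval_reflPoly hβ]
  congr 1
  congr 1
  ext i
  have h1 : inner ℝ β (refl β α) = - inner ℝ α β := by
    rw [refl_apply hβ, inner_sub_right, inner_smul_right, hβ, real_inner_comm]
    ring
  have h2 : ((refl β α) i : ℂ) = α i - (inner ℝ α β : ℝ) * β i := by
    rw [refl_apply hβ, real_inner_comm]
    simp
  rw [cRefl, cRefl, eval_cRefl_linForm, cRefl, eval_cRefl_linForm, cRefl, eval_linForm_refl hβ,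
    h1, h2]
  push_cast
  ring

theorem reflPoly_dividedDifference {α β : V N} (hα : inner ℝ α α = 2) (hβ : inner ℝ β β = 2)
    (p : Poly N) :
    reflPoly β (dividedDifference α p) = dividedDifference (refl β α) (reflPoly β p) := by
  have h : inner ℝ (refl β α) (refl β α) = 2 := by rwa [LinearIsometryEquiv.inner_map_map]
  apply mul_left_cancel₀ (linForm_ne_zero h)
  rw [linForm_mul_dividedDifference h, ← reflPoly_linForm hβ, ← map_mul,
    linForm_mul_dividedDifference hα, map_sub, reflPoly_reflPoly hα hβ]

theorem pderiv_X_eq (i j : Fin N) : pderiv i (X j : Poly N) = C (if i = j then 1 else 0) := by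
  rw [pderiv_X, Pi.single_apply]
  by_cases h : i = j
  · simp [h]
  · simp [h, Ne.symm h]

theorem pderiv_linForm (β : V N) (i : Fin N) : pderiv i (linForm β) = C ((β i : ℝ) : ℂ) := by
  simp [linForm, pderiv_X, Pi.single_apply, Derivation.leibniz]

theorem sum_coord_sq {β : V N} (hβ : inner ℝ β β = 2) : ∑ j, (β j : ℂ) * (β j : ℂ) = 2 := by
  rw [inner_eq_sum] at hβ
  exact_mod_cast hβ

theorem pderiv_reflPoly_X {β : V N} (hβ : inner ℝ β β = 2) (i l : Fin N) :
    pderiv i (reflPoly β (X l)) =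
      C (if i = l then 1 else 0) - C ((β l : ℝ) : ℂ) * C ((β i : ℝ) : ℂ) := by
  rw [reflPoly_X hβ, map_sub, pderiv_C_mul, pderiv_linForm, pderiv_X_eq]

theorem sum_pderiv_reflPoly_X {β : V N} (hβ : inner ℝ β β = 2) (l : Fin N) :
    ∑ j, C ((β j : ℝ) : ℂ) * pderiv j (reflPoly β (X l)) = -C ((β l : ℝ) : ℂ) := by
  simp only [pderiv_reflPoly_X hβ, ← C_mul, ← C_sub, ← map_sum, ← C_neg]
  congr 1
  have h : ∀ j, (β j : ℂ) * ((if j = l then 1 else 0) - β l * β j) =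
      (if j = l then (β j : ℂ) else 0) - β l * (β j * β j) := fun j => by
    split_ifs <;> ring
  simp only [h, Finset.sum_sub_distrib, ← Finset.mul_sum, sum_coord_sq hβ, Finset.sum_ite_eq',
    Finset.mem_univ, if_true]
  ring

theorem sum_pderiv_mul (β : V N) (p q : Poly N) :
    ∑ j, C ((β j : ℝ) : ℂ) * pderiv j (p * q) =
      p * (∑ j, C ((β j : ℝ) : ℂ) * pderiv j q) + (∑ j, C ((β j : ℝ) : ℂ) * pderiv j p) * q := by
  rw [Finset.mul_sum, Finset.sum_mul, ← Finset.sum_add_distrib]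
  refine Finset.sum_congr rfl fun j _ => ?_
  rw [pderiv_mul]
  ring

/-- The chain rule for the composition with a reflection. -/
theorem reflPoly_pderiv {β : V N} (hβ : inner ℝ β β = 2) (i : Fin N) (p : Poly N) :
    reflPoly β (pderiv i p) = pderiv i (reflPoly β p) -
      C ((β i : ℝ) : ℂ) * ∑ j, C ((β j : ℝ) : ℂ) * pderiv j (reflPoly β p) := by
  induction p using MvPolynomial.induction_on with
  | C a => simp [← algebraMap_eq]
  | add p q hp hq =>
    simp only [map_add, hp, hq, mul_add, Finset.sum_add_distrib]
    ring
  | mul_X p l hp =>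
    have hδ : reflPoly β (pderiv i (X l : Poly N)) = C (if i = l then 1 else 0) := by
      rw [pderiv_X_eq, ← algebraMap_eq, AlgHom.commutes]
    rw [map_mul (reflPoly β), sum_pderiv_mul, sum_pderiv_reflPoly_X hβ, pderiv_mul, pderiv_mul,
      map_add, map_mul, map_mul, hp, pderiv_reflPoly_X hβ, hδ]
    ring

theorem map_C_mul (L : Module.End ℂ (Poly N)) (c : ℂ) (p : Poly N) :
    L (C c * p) = C c * L p := by
  rw [← smul_eq_C_mul, ← smul_eq_C_mul, map_smul]

theorem dunklPoly_apply (Rp : Finset (V N)) (k : V N → ℝ) (i : Fin N) (p : Poly N) :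
    dunklPoly Rp k i p = pderiv i p +
      ∑ α ∈ Rp, C ((k α * α i : ℝ) : ℂ) * dividedDifference α p := by
  simp [dunklPoly, LinearMap.sum_apply, smul_eq_C_mul]

/-- The commutation relation `T_i σ_β = σ_β T_i + β_i T_β σ_β`, where `T_β = ∑ β_j T_j`. -/
theorem IsRootData.dunklPoly_reflPoly (hR : IsRootData Rp k) {β : V N} (hβ : β ∈ Rp) (i : Fin N)
    (p : Poly N) :
    dunklPoly Rp k i (reflPoly β p) = reflPoly β (dunklPoly Rp k i p) +
      C ((β i : ℝ) : ℂ) * ∑ j, C ((β j : ℝ) : ℂ) * dunklPoly Rp k j (reflPoly β p) := by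
  have hβ2 := hR.inner_self β hβ
  have h1 : reflPoly β (∑ α ∈ Rp, C ((k α * α i : ℝ) : ℂ) * dividedDifference α p) =
      ∑ α ∈ Rp, C ((k α * (refl β α) i : ℝ) : ℂ) * dividedDifference α (reflPoly β p) := by
    rw [map_sum, ← hR.sum_refl (fun r α => C ((r * (refl β α) i : ℝ) : ℂ) *
      dividedDifference α (reflPoly β p)) (fun r α hα => ?_) hβ]
    · refine Finset.sum_congr rfl fun α hα => ?_
      simp only [refl_refl]
      rw [map_mul, reflPoly_dividedDifference (hR.inner_self α hα) hβ2, ← algebraMap_eq,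
        AlgHom.commutes]
    · simp only [map_neg, dividedDifference_neg (hR.inner_self α hα), PiLp.neg_apply, mul_neg,
        Complex.ofReal_neg, neg_mul, neg_neg]
  have h2 : ∑ j, C ((β j : ℝ) : ℂ) * ∑ α ∈ Rp,
        C ((k α * α j : ℝ) : ℂ) * dividedDifference α (reflPoly β p) =
      ∑ α ∈ Rp, C ((k α * inner ℝ α β : ℝ) : ℂ) * dividedDifference α (reflPoly β p) := by
    simp only [Finset.mul_sum]
    rw [Finset.sum_comm]
    refine Finset.sum_congr rfl fun α _ => ?_
    simp only [← mul_assoc, ← Finset.sum_mul, ← C_mul, ← map_sum]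
    congr 2
    rw [inner_eq_sum]
    push_cast
    rw [Finset.mul_sum]
    exact Finset.sum_congr rfl fun j _ => by ring
  have h3 : ∑ α ∈ Rp, C ((k α * (refl β α) i : ℝ) : ℂ) * dividedDifference α (reflPoly β p) =
      ∑ α ∈ Rp, C ((k α * α i : ℝ) : ℂ) * dividedDifference α (reflPoly β p) -
      C ((β i : ℝ) : ℂ) *
        ∑ α ∈ Rp, C ((k α * inner ℝ α β : ℝ) : ℂ) * dividedDifference α (reflPoly β p) := by
    rw [Finset.mul_sum, ← Finset.sum_sub_distrib]
    refine Finset.sum_congr rfl fun α _ => ?_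
    rw [← mul_assoc, ← sub_mul, ← C_mul, ← C_sub, refl_apply hβ2, real_inner_comm]
    congr 2
    simp
    ring
  simp only [dunklPoly_apply, mul_add, Finset.sum_add_distrib]
  rw [map_add, h1, h2, h3, reflPoly_pderiv hβ2]
  ring

/-! ### Commutativity of Dunkl operators -/

theorem IsRootData.dunklPoly_C (hR : IsRootData Rp k) (i : Fin N) (c : ℂ) :
    dunklPoly Rp k i (C c) = 0 := by
  rw [dunklPoly_apply, pderiv_C, zero_add]
  exact Finset.sum_eq_zero fun α hα => by rw [dividedDifference_C (hR.inner_self α hα), mul_zero]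

/-- The commutation relation of Dunkl operators and multiplications by coordinates. -/
theorem IsRootData.dunklPoly_X_mul (hR : IsRootData Rp k) (i j : Fin N) (p : Poly N) :
    dunklPoly Rp k i (X j * p) = X j * dunklPoly Rp k i p + C (if i = j then 1 else 0) * p +
      ∑ α ∈ Rp, C ((k α * α i * α j : ℝ) : ℂ) * reflPoly α p := by
  have h1 : ∑ α ∈ Rp, C ((k α * α i : ℝ) : ℂ) * dividedDifference α (X j * p) =
      X j * (∑ α ∈ Rp, C ((k α * α i : ℝ) : ℂ) * dividedDifference α p) +
        ∑ α ∈ Rp, C ((k α * α i * α j : ℝ) : ℂ) * reflPoly α p := by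
    rw [Finset.mul_sum, ← Finset.sum_add_distrib]
    refine Finset.sum_congr rfl fun α hα => ?_
    rw [dividedDifference_X_mul (hR.inner_self α hα), Complex.ofReal_mul (k α * α i), C_mul]
    ring
  rw [dunklPoly_apply, dunklPoly_apply, h1, pderiv_mul, pderiv_X_eq]
  ring

/-- Dunkl operators commute. The commutator `[T_i, T_j]` commutes with the multiplications by the
coordinates, because `[[T_i, T_j], x_l] = ∑ k(α) α_l (α_j [T_i, σ_α] - α_i [T_j, σ_α])` and
`[T_i, σ_α] = α_i T_α σ_α`; as it annihilates constants, it vanishes. -/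
theorem IsRootData.dunklPoly_comm (hR : IsRootData Rp k) (i j : Fin N) (p : Poly N) :
    dunklPoly Rp k i (dunklPoly Rp k j p) = dunklPoly Rp k j (dunklPoly Rp k i p) := by
  induction p using MvPolynomial.induction_on with
  | C a => simp only [hR.dunklPoly_C, map_zero]
  | add p q hp hq => simp only [map_add, hp, hq]
  | mul_X p l hp =>
    have key : ∀ i j : Fin N, dunklPoly Rp k i (dunklPoly Rp k j (X l * p)) =
        X l * dunklPoly Rp k i (dunklPoly Rp k j p) +
        (C (if i = l then 1 else 0) * dunklPoly Rp k j p +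
          C (if j = l then 1 else 0) * dunklPoly Rp k i p) +
        (∑ α ∈ Rp, C ((k α * α i * α l : ℝ) : ℂ) * reflPoly α (dunklPoly Rp k j p) +
          ∑ α ∈ Rp, C ((k α * α j * α l : ℝ) : ℂ) * reflPoly α (dunklPoly Rp k i p)) +
        ∑ α ∈ Rp, C ((k α * α i * α j * α l : ℝ) : ℂ) *
          ∑ m, C ((α m : ℝ) : ℂ) * dunklPoly Rp k m (reflPoly α p) := fun i j => by
      have h : ∑ α ∈ Rp, C ((k α * α j * α l : ℝ) : ℂ) * dunklPoly Rp k i (reflPoly α p) =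
          ∑ α ∈ Rp, C ((k α * α j * α l : ℝ) : ℂ) * reflPoly α (dunklPoly Rp k i p) +
          ∑ α ∈ Rp, C ((k α * α i * α j * α l : ℝ) : ℂ) *
            ∑ m, C ((α m : ℝ) : ℂ) * dunklPoly Rp k m (reflPoly α p) := by
        rw [← Finset.sum_add_distrib]
        refine Finset.sum_congr rfl fun α hα => ?_
        rw [hR.dunklPoly_reflPoly hα, mul_add, ← mul_assoc, ← C_mul, ← Complex.ofReal_mul]
        congr 4
        ring
      rw [hR.dunklPoly_X_mul j l p, map_add, map_add, hR.dunklPoly_X_mul i l, map_sum]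
      simp only [map_C_mul]
      rw [h]
      ring
    rw [mul_comm p, key i j, key j i, hp]
    -- The remaining double sum is symmetric in `i` and `j`.
    have h : ∑ α ∈ Rp, C ((k α * α j * α i * α l : ℝ) : ℂ) *
          ∑ m, C ((α m : ℝ) : ℂ) * dunklPoly Rp k m (reflPoly α p) =
        ∑ α ∈ Rp, C ((k α * α i * α j * α l : ℝ) : ℂ) *
          ∑ m, C ((α m : ℝ) : ℂ) * dunklPoly Rp k m (reflPoly α p) :=
      Finset.sum_congr rfl fun α _ => by rw [mul_right_comm (k α)]
    rw [h]
    ring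

/-! ### Euler's identity and degrees -/

/-- The Dunkl analogue `∑ x_i T_i = E + ∑ k(α) (1 - σ_α)` of the Euler operator `E`, on homogeneous
polynomials. -/
theorem IsRootData.sum_X_mul_dunklPoly (hR : IsRootData Rp k) {p : Poly N} {n : ℕ}
    (hp : p.IsHomogeneous n) :
    ∑ i, X i * dunklPoly Rp k i p =
      n • p + ∑ α ∈ Rp, C ((k α : ℝ) : ℂ) * (p - reflPoly α p) := by
  simp only [dunklPoly_apply, mul_add, Finset.sum_add_distrib, hp.sum_X_mul_pderiv]
  congr 1
  simp only [Finset.mul_sum]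
  rw [Finset.sum_comm]
  refine Finset.sum_congr rfl fun α hα => ?_
  rw [← linForm_mul_dividedDifference (hR.inner_self α hα), linForm, Finset.sum_mul,
    Finset.mul_sum]
  refine Finset.sum_congr rfl fun i _ => ?_
  rw [Complex.ofReal_mul, C_mul]
  ring

theorem IsRootData.dunklPoly_isHomogeneous (hR : IsRootData Rp k) (i : Fin N) {p : Poly N} {n : ℕ}
    (hp : p.IsHomogeneous (n + 1)) : (dunklPoly Rp k i p).IsHomogeneous n := by
  rw [dunklPoly_apply]
  refine IsHomogeneous.add hp.pderiv (IsHomogeneous.sum _ _ _ fun α hα => ?_)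
  exact (dividedDifference_isHomogeneous (hR.inner_self α hα) hp).C_mul _

/-! ### The pairing `[p, q]_k` -/

theorem prod_ofFn_pow_add_single {M : Type*} [Monoid M] {n : ℕ} (a : Fin n → M)
    (ha : ∀ i j, Commute (a i) (a j)) (ν : Fin n → ℕ) (i : Fin n) :
    (List.ofFn fun j => a j ^ (ν j + if j = i then 1 else 0)).prod =
      (List.ofFn fun j => a j ^ ν j).prod * a i := by
  induction n with
  | zero => exact i.elim0
  | succ n ih =>
    rw [List.ofFn_succ, List.ofFn_succ, List.prod_cons, List.prod_cons]
    cases i using Fin.cases with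
    | zero =>
      have hc : Commute (a 0) (List.ofFn fun j : Fin n => a j.succ ^ ν j.succ).prod := by
        refine Commute.list_prod_right _ _ fun x hx => ?_
        obtain ⟨j, rfl⟩ := (List.mem_ofFn' _ _).1 hx
        exact (ha 0 j.succ).pow_right _
      simp only [Fin.succ_ne_zero, if_true, if_false, add_zero, pow_succ, mul_assoc]
      rw [hc.eq]
    | succ i =>
      simp only [Fin.succ_inj, (Fin.succ_ne_zero i).symm, if_false, add_zero, mul_assoc]
      rw [ih (fun j => a j.succ) (fun i j => ha _ _)]

theorem polyOp_eq_sum (p : Poly N) {S : Finset (Fin N →₀ ℕ)} (hS : p.support ⊆ S) :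
    polyOp Rp k p = ∑ ν ∈ S, coeff ν p • (List.ofFn fun i => dunklPoly Rp k i ^ ν i).prod :=
  Finset.sum_subset hS fun ν _ hν => by rw [notMem_support_iff.1 hν, zero_smul]

theorem polyOp_add (p q : Poly N) : polyOp Rp k (p + q) = polyOp Rp k p + polyOp Rp k q := by
  classical
  rw [polyOp_eq_sum p (Finset.subset_union_left (s₂ := q.support)),
    polyOp_eq_sum q (Finset.subset_union_right (s₁ := p.support)),
    polyOp_eq_sum _ support_add, ← Finset.sum_add_distrib]
  simp only [coeff_add, add_smul]

theorem polyOp_smul (c : ℂ) (p : Poly N) : polyOp Rp k (c • p) = c • polyOp Rp k p := by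
  rw [polyOp_eq_sum _ (support_smul (a := c)), polyOp_eq_sum p (Finset.Subset.refl _),
    Finset.smul_sum]
  simp only [coeff_smul, smul_assoc]

theorem polyOp_monomial (ν : Fin N →₀ ℕ) (c : ℂ) :
    polyOp Rp k (monomial ν c) = c • (List.ofFn fun i => dunklPoly Rp k i ^ ν i).prod := by
  rw [polyOp_eq_sum _ support_monomial_subset, Finset.sum_singleton, coeff_monomial, if_pos rfl]

theorem IsRootData.polyOp_X_mul (hR : IsRootData Rp k) (i : Fin N) (p : Poly N) :
    polyOp Rp k (X i * p) = polyOp Rp k p * dunklPoly Rp k i := by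
  induction p using MvPolynomial.induction_on' with
  | add p q hp hq => rw [mul_add, polyOp_add, polyOp_add, hp, hq, add_mul]
  | monomial ν c =>
    rw [mul_comm, ← pow_one (X i), ← monomial_add_single, polyOp_monomial, polyOp_monomial,
      smul_mul_assoc, ← prod_ofFn_pow_add_single _
        (fun i j => LinearMap.ext fun p => hR.dunklPoly_comm i j p)]
    simp [Finsupp.single_apply, eq_comm]

theorem pairing_add_left (p q r : Poly N) :
    pairing Rp k (p + q) r = pairing Rp k p r + pairing Rp k q r := by
  simp [pairing, polyOp_add]

theorem pairing_smul_left (c : ℂ) (p q : Poly N) :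
    pairing Rp k (c • p) q = c * pairing Rp k p q := by
  simp [pairing, polyOp_smul]

theorem pairing_add_right (p q r : Poly N) :
    pairing Rp k p (q + r) = pairing Rp k p q + pairing Rp k p r := by
  simp [pairing]

theorem pairing_smul_right (c : ℂ) (p q : Poly N) :
    pairing Rp k p (c • q) = c * pairing Rp k p q := by
  simp [pairing]

/-- Multiplication by `x_i` is adjoint to `T_i`. -/
theorem IsRootData.pairing_X_mul (hR : IsRootData Rp k) (i : Fin N) (p q : Poly N) :
    pairing Rp k (X i * p) q = pairing Rp k p (dunklPoly Rp k i q) := by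
  rw [pairing, hR.polyOp_X_mul]
  rfl

theorem mem_multiIndices {n : ℕ} {ν : Fin N →₀ ℕ} :
    ν ∈ Finset.finsuppAntidiag (Finset.univ : Finset (Fin N)) n ↔ ν.degree = n := by
  simp [Finsupp.degree_eq_sum]

theorem IsOrthonormalBasis.coord_eq_left (hφ : IsOrthonormalBasis Rp k φ) (μ : Fin N →₀ ℕ)
    (p : Poly N) : φ.coord μ p = pairing Rp k p (φ μ) := by
  let f : Poly N →ₗ[ℂ] ℂ :=
    { toFun := fun p => pairing Rp k p (φ μ)
      map_add' := fun p q => pairing_add_left p q _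
      map_smul' := fun c p => pairing_smul_left c p _ }
  have : φ.coord μ = f := φ.ext fun ν => by
    simp [f, hφ.1, Finsupp.single_apply]
  rw [this]
  rfl

theorem IsOrthonormalBasis.coord_eq_right (hφ : IsOrthonormalBasis Rp k φ) (μ : Fin N →₀ ℕ)
    (p : Poly N) : φ.coord μ p = pairing Rp k (φ μ) p := by
  let f : Poly N →ₗ[ℂ] ℂ :=
    { toFun := fun p => pairing Rp k (φ μ) p
      map_add' := fun p q => pairing_add_right _ p q
      map_smul' := fun c p => pairing_smul_right c _ p }
  have : φ.coord μ = f := φ.ext fun ν => by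
    simp [f, hφ.1, Finsupp.single_apply, eq_comm]
  rw [this]
  rfl

theorem IsOrthonormalBasis.sum_coord (hφ : IsOrthonormalBasis Rp k φ) {p : Poly N} {n : ℕ}
    (hp : p.IsHomogeneous n) :
    ∑ μ ∈ Finset.finsuppAntidiag Finset.univ n, φ.coord μ p • φ μ = p := by
  have h : ∑ μ ∈ Finset.finsuppAntidiag Finset.univ n, (φ.coord μ).smulRight (φ μ) =
      homogeneousComponent n := φ.ext fun ν => by
    rw [homogeneousComponent_of_mem (hφ.2.1 ν), LinearMap.sum_apply]
    simp only [LinearMap.smulRight_apply, Module.Basis.coord_apply, Module.Basis.repr_self,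
      Finsupp.single_apply, ite_smul, one_smul, zero_smul, Finset.sum_ite_eq, mem_multiIndices,
      eq_comm]
  have h' := LinearMap.congr_fun h p
  rw [homogeneousComponent_eq_self hp, LinearMap.sum_apply] at h'
  exact h'

/-! ### The homogeneous parts of the generalized exponential kernel -/

/-- The reproducing kernel `K_n(·, w) = ∑_{|ν| = n} φ_ν(w) φ_ν` of the homogeneous polynomials of
degree `n`, as a polynomial in its first variable. It is the part of degree `n` of the generalized
exponential kernel. -/
def kerPoly (φ : Module.Basis (Fin N →₀ ℕ) ℂ (Poly N)) (n : ℕ) (w : Fin N → ℂ) : Poly N :=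
  ∑ ν ∈ Finset.finsuppAntidiag (Finset.univ : Finset (Fin N)) n, eval w (φ ν) • φ ν

theorem IsOrthonormalBasis.kerPoly_isHomogeneous (hφ : IsOrthonormalBasis Rp k φ) (n : ℕ)
    (w : Fin N → ℂ) : (kerPoly φ n w).IsHomogeneous n :=
  IsHomogeneous.sum _ _ _ fun ν hν => by
    rw [smul_eq_C_mul, ← mem_multiIndices.1 hν]
    exact (hφ.2.1 ν).C_mul _

/-- The reproducing property of `K_n`. -/
theorem IsOrthonormalBasis.sum_pairing_mul_eval (hφ : IsOrthonormalBasis Rp k φ) {n : ℕ}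
    {p : Poly N} (hp : p.IsHomogeneous n) (w : Fin N → ℂ) :
    ∑ ν ∈ Finset.finsuppAntidiag Finset.univ n, pairing Rp k p (φ ν) * eval w (φ ν) =
      eval w p := by
  conv_rhs => rw [← hφ.sum_coord hp, map_sum]
  simp only [hφ.coord_eq_left, smul_eval]

theorem IsOrthonormalBasis.kerPoly_zero (hφ : IsOrthonormalBasis Rp k φ) (w : Fin N → ℂ) :
    kerPoly φ 0 w = 1 := by
  have h0 : φ 0 = C (coeff 0 (φ 0)) := by
    conv_lhs => rw [← homogeneousComponent_eq_self (hφ.2.1 0), map_zero, homogeneousComponent_zero]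
  have h1 := hφ.1 0 0
  rw [if_pos rfl, pairing] at h1
  have h2 : polyOp Rp k (φ 0) = coeff 0 (φ 0) • 1 := by
    rw [h0, C_apply, polyOp_monomial]
    congr 1
    · simp
    · simp
  rw [h2, h0] at h1
  have h3 : kerPoly φ 0 w = eval w (φ 0) • φ 0 := by
    simp [kerPoly]
  rw [h3, h0]
  simp only [LinearMap.smul_apply, Module.End.one_apply, smul_eval, eval_C, coeff_C, if_true]
    at h1 ⊢
  rw [smul_eq_C_mul, ← C_mul, h1, C_1]

theorem IsRootData.dunklPoly_kerPoly_zero (hR : IsRootData Rp k)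
    (hφ : IsOrthonormalBasis Rp k φ) (i : Fin N) (w : Fin N → ℂ) :
    dunklPoly Rp k i (kerPoly φ 0 w) = 0 := by
  rw [hφ.kerPoly_zero, ← C_1, hR.dunklPoly_C]

/-- The functions `K_n(·, w)` are the homogeneous parts of a joint eigenfunction of the Dunkl
operators. -/
theorem IsRootData.dunklPoly_kerPoly (hR : IsRootData Rp k) (hφ : IsOrthonormalBasis Rp k φ)
    (i : Fin N) (n : ℕ) (w : Fin N → ℂ) :
    dunklPoly Rp k i (kerPoly φ (n + 1) w) = w i • kerPoly φ n w := by
  have h : ∀ ν ∈ Finset.finsuppAntidiag (Finset.univ : Finset (Fin N)) (n + 1),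
      eval w (φ ν) • dunklPoly Rp k i (φ ν) =
        ∑ μ ∈ Finset.finsuppAntidiag Finset.univ n,
          (pairing Rp k (X i * φ μ) (φ ν) * eval w (φ ν)) • φ μ := fun ν hν => by
    have hν' : (φ ν).IsHomogeneous (n + 1) := mem_multiIndices.1 hν ▸ hφ.2.1 ν
    rw [← hφ.sum_coord (hR.dunklPoly_isHomogeneous i hν'), Finset.smul_sum]
    refine Finset.sum_congr rfl fun μ _ => ?_
    rw [hφ.coord_eq_right, ← hR.pairing_X_mul, smul_smul, mul_comm]
  rw [kerPoly, map_sum]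
  simp only [map_smul]
  rw [Finset.sum_congr rfl h, Finset.sum_comm, kerPoly, Finset.smul_sum]
  refine Finset.sum_congr rfl fun μ hμ => ?_
  have hμ' : (X i * φ μ).IsHomogeneous (n + 1) := by
    rw [add_comm, ← mem_multiIndices.1 hμ]
    exact (isHomogeneous_X ℂ i).mul (hφ.2.1 μ)
  rw [← Finset.sum_smul, hφ.sum_pairing_mul_eval hμ', smul_smul, map_mul, eval_X]

/-! ### The estimate of the homogeneous parts -/

theorem sum_norm_sq_cRefl {α : V N} (hα : inner ℝ α α = 2) (z : Fin N → ℂ) :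
    ∑ i, ‖cRefl α z i‖ ^ 2 = ∑ i, ‖z i‖ ^ 2 := by
  set c := eval z (linForm α) with hc
  have hc' := eval_linForm α z
  rw [← hc] at hc'
  have hre : ∑ i, α i * (z i).re = c.re := by simp [hc']
  have him : ∑ i, α i * (z i).im = c.im := by simp [hc']
  have h : ∀ i, ‖cRefl α z i‖ ^ 2 = ‖z i‖ ^ 2 - 2 * (α i * (z i).re) * c.re
      - 2 * (α i * (z i).im) * c.im + α i * α i * (c.re ^ 2 + c.im ^ 2) := fun i => by
    rw [← Complex.normSq_eq_norm_sq, ← Complex.normSq_eq_norm_sq, Complex.normSq_apply,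
      Complex.normSq_apply, cRefl, ← hc]
    simp
    ring
  rw [inner_eq_sum] at hα
  simp only [h, Finset.sum_add_distrib, Finset.sum_sub_distrib, ← Finset.sum_mul,
    ← Finset.mul_sum, hre, him, hα]
  ring

theorem isCompact_setOf_sum_norm_sq_le (r : ℝ) :
    IsCompact {z : Fin N → ℂ | ∑ i, ‖z i‖ ^ 2 ≤ r ^ 2} := by
  refine Metric.isCompact_of_isClosed_isBounded
    (isClosed_le (by fun_prop) continuous_const) ?_
  refine (Metric.isBounded_closedBall (x := (0 : Fin N → ℂ)) (r := |r|)).subset fun z hz => ?_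
  rw [mem_closedBall_zero_iff, pi_norm_le_iff_of_nonneg (abs_nonneg r)]
  intro i
  refine abs_le_of_sq_le_sq' ?_ (abs_nonneg r) |>.2
  rw [sq_abs]
  exact (Finset.single_le_sum (f := fun i => ‖z i‖ ^ 2) (fun i _ => sq_nonneg _)
    (Finset.mem_univ i)).trans hz

/-- The estimate `|K_n(z, w)| ≤ (r |w|)^n / n!` on the Hermitian ball of radius `r`. The identity
`⟨z, w⟩ K_{n-1} = n K_n + ∑ k(α) (K_n - K_n ∘ σ_α)` is applied at a point where `|K_n(·, w)|`
attains its maximum over the ball. As the ball is invariant under reflections and `k ≥ 0`, the sum over the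
roots can only increase the modulus of the right-hand side. -/
theorem IsRootData.norm_eval_kerPoly_le (hR : IsRootData Rp k) (hφ : IsOrthonormalBasis Rp k φ)
    {r : ℝ} (hr : 0 ≤ r) (w : Fin N → ℂ) (n : ℕ) {z : Fin N → ℂ} (hz : ∑ i, ‖z i‖ ^ 2 ≤ r ^ 2) :
    ‖eval z (kerPoly φ n w)‖ ≤ (r * ∑ i, ‖w i‖) ^ n / n.factorial := by
  induction n generalizing z with
  | zero => simp [hφ.kerPoly_zero]
  | succ n ih =>
    set P := kerPoly φ (n + 1) w with hP
    obtain ⟨z₀, hz₀, hmax⟩ := (isCompact_setOf_sum_norm_sq_le (N := N) r).exists_isMaxOn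
      ⟨0, by simp [sq_nonneg]⟩ (f := fun z => ‖eval z P‖)
      (MvPolynomial.continuous_eval P).norm.continuousOn
    have hmax' : ∀ z : Fin N → ℂ, ∑ i, ‖z i‖ ^ 2 ≤ r ^ 2 → ‖eval z P‖ ≤ ‖eval z₀ P‖ :=
      fun z hz => hmax hz
    refine (hmax' z hz).trans ?_
    have hT : ∀ i, dunklPoly Rp k i P = w i • kerPoly φ n w := fun i =>
      hR.dunklPoly_kerPoly hφ i n w
    have hE := congrArg (eval z₀) (hR.sum_X_mul_dunklPoly (hφ.kerPoly_isHomogeneous (n + 1) w))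
    simp only [← hP, hT] at hE
    simp only [map_sum, map_add, map_mul, map_sub, eval_X, eval_C, smul_eval, map_nsmul,
      mul_sub, Finset.sum_sub_distrib] at hE
    have h1 : ‖∑ i, z₀ i * (w i * eval z₀ (kerPoly φ n w))‖ ≤
        r * (∑ i, ‖w i‖) * ((r * ∑ i, ‖w i‖) ^ n / n.factorial) := by
      simp only [← mul_assoc, ← Finset.sum_mul]
      rw [norm_mul]
      refine mul_le_mul ?_ (ih hz₀) (norm_nonneg _) (by positivity)
      refine (norm_sum_le _ _).trans ?_
      rw [Finset.mul_sum]
      refine Finset.sum_le_sum fun i _ => ?_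
      rw [norm_mul]
      refine mul_le_mul_of_nonneg_right (abs_le_of_sq_le_sq' ?_ hr).2 (norm_nonneg _)
      exact (Finset.single_le_sum (f := fun i => ‖z₀ i‖ ^ 2) (fun i _ => sq_nonneg _)
        (Finset.mem_univ i)).trans hz₀
    have h2 : ‖∑ α ∈ Rp, (k α : ℂ) * eval z₀ (reflPoly α P)‖ ≤ (∑ α ∈ Rp, k α) * ‖eval z₀ P‖ := by
      refine (norm_sum_le _ _).trans ?_
      rw [Finset.sum_mul]
      refine Finset.sum_le_sum fun α hα => ?_
      rw [norm_mul, Complex.norm_real, Real.norm_of_nonneg (hR.nonneg α hα),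
        eval_reflPoly (hR.inner_self α hα)]
      refine mul_le_mul_of_nonneg_left (hmax' _ ?_) (hR.nonneg α hα)
      rw [sum_norm_sq_cRefl (hR.inner_self α hα)]
      exact hz₀
    have h3 : (((n : ℝ) + 1 + ∑ α ∈ Rp, k α : ℝ) : ℂ) * eval z₀ P =
        ∑ i, z₀ i * (w i * eval z₀ (kerPoly φ n w)) +
          ∑ α ∈ Rp, (k α : ℂ) * eval z₀ (reflPoly α P) := by
      rw [hE, ← Finset.sum_mul, nsmul_eq_mul]
      push_cast
      ring
    have hγ : 0 ≤ ∑ α ∈ Rp, k α := Finset.sum_nonneg hR.nonneg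
    have h4 := congrArg norm h3
    rw [norm_mul, Complex.norm_real, Real.norm_of_nonneg (by positivity)] at h4
    have h5 := (h4.le.trans (norm_add_le _ _)).trans (add_le_add h1 h2)
    rw [Nat.factorial_succ, pow_succ, le_div_iff₀ (by positivity)]
    have hf : (0 : ℝ) < n.factorial := by positivity
    have h6 : ((n : ℝ) + 1) * ‖eval z₀ P‖ ≤
        r * (∑ i, ‖w i‖) * ((r * ∑ i, ‖w i‖) ^ n / n.factorial) := by linarith
    rw [mul_div_assoc', le_div_iff₀ hf] at h6
    push_cast
    linarith

/-! ### The generating function of the Hermite polynomials as a Cauchy product -/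

theorem IsRootData.laplacian_kerPoly (hR : IsRootData Rp k) (hφ : IsOrthonormalBasis Rp k φ)
    (n : ℕ) (w : Fin N → ℂ) :
    laplacian Rp k (kerPoly φ (n + 2) w) = (∑ i, w i ^ 2) • kerPoly φ n w := by
  rw [laplacian, LinearMap.sum_apply, Finset.sum_smul]
  refine Finset.sum_congr rfl fun i _ => ?_
  rw [pow_two, Module.End.mul_apply, hR.dunklPoly_kerPoly hφ, map_smul, hR.dunklPoly_kerPoly hφ,
    smul_smul, pow_two]

theorem IsRootData.laplacian_pow_kerPoly (hR : IsRootData Rp k) (hφ : IsOrthonormalBasis Rp k φ)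
    (n j : ℕ) (w : Fin N → ℂ) :
    (laplacian Rp k ^ j) (kerPoly φ (n + 2 * j) w) = (∑ i, w i ^ 2) ^ j • kerPoly φ n w := by
  induction j with
  | zero => simp
  | succ j ih =>
    rw [pow_succ, Module.End.mul_apply, mul_add, ← add_assoc, mul_one, hR.laplacian_kerPoly hφ,
      map_smul, ih, smul_smul, pow_succ, mul_comm]

theorem eval_smul_of_isHomogeneous {p : Poly N} {n : ℕ} (hp : p.IsHomogeneous n) (c : ℂ)
    (z : Fin N → ℂ) : eval (c • z) p = c ^ n * eval z p := by
  rw [eval_eq, eval_eq, Finset.mul_sum]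
  refine Finset.sum_congr rfl fun ν hν => ?_
  have h : ∑ i ∈ ν.support, ν i = n := by
    by_contra h
    exact (mem_support_iff.1 hν) (hp.coeff_eq_zero h)
  simp only [Pi.smul_apply, smul_eq_mul, mul_pow, Finset.prod_mul_distrib,
    Finset.prod_pow_eq_pow_sum, h]
  ring

/-- The coefficients of the power series of `t ↦ exp (x t²)`. -/
def expSqCoeff (x : ℂ) (n : ℕ) : ℂ :=
  if Even n then x ^ (n / 2) / (n / 2).factorial else 0

/-- Since `Δ_k` acts on `K_m(·, w)` as `l(w)` times a shift of the degree by two, `∑_n L_n` is the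
Cauchy product of the series of `exp (-l(w))` and of `K(2z, w)`. -/
theorem IsRootData.hermiteSum_eq (hR : IsRootData Rp k) (hφ : IsOrthonormalBasis Rp k φ)
    (n : ℕ) (z w : Fin N → ℂ) :
    hermiteSum Rp k φ n z w = ∑ p ∈ Finset.HasAntidiagonal.antidiagonal n,
      expSqCoeff (-∑ i, w i ^ 2) p.1 * eval ((2 : ℂ) • z) (kerPoly φ p.2 w) := by
  have h1 : hermiteSum Rp k φ n z w = ∑ j ∈ Finset.range (n / 2 + 1),
      (2 : ℂ) ^ n * (((-1 : ℂ) ^ j / (4 ^ j * (j.factorial : ℂ))) *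
        eval z ((laplacian Rp k ^ j) (kerPoly φ n w))) := by
    rw [hermiteSum, ← Finset.mul_sum]
    simp only [kerPoly, map_sum, map_smul, smul_eval, Finset.mul_sum]
    rw [Finset.sum_comm]
    refine Finset.sum_congr rfl fun ν hν => ?_
    rw [hermite, mem_multiIndices.1 hν, smul_eval, map_sum, Finset.mul_sum, Finset.sum_mul]
    refine Finset.sum_congr rfl fun j _ => ?_
    rw [smul_eval]
    ring
  rw [h1, Finset.Nat.sum_antidiagonal_eq_sum_range_succ
    (fun i m => expSqCoeff (-∑ i, w i ^ 2) i * eval ((2 : ℂ) • z) (kerPoly φ m w))]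
  symm
  -- Only the even indices `i = 2 j` contribute to the Cauchy product.
  rw [← Finset.sum_filter_of_ne (p := Even) fun i _ h => by
    by_contra h'
    exact h (by rw [expSqCoeff, if_neg h', zero_mul])]
  refine Finset.sum_nbij' (fun i => i / 2) (fun j => 2 * j) ?_ ?_ ?_ ?_ ?_
  · intro i hi
    simp only [Finset.mem_filter, Finset.mem_range] at hi ⊢
    omega
  · intro j hj
    simp only [Finset.mem_filter, Finset.mem_range] at hj ⊢
    exact ⟨by omega, even_two_mul j⟩
  · intro i hi
    exact Nat.two_mul_div_two_of_even (Finset.mem_filter.1 hi).2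
  · intro j _
    omega
  · intro i hi
    obtain ⟨hi1, hi2⟩ := Finset.mem_filter.1 hi
    rw [Finset.mem_range] at hi1
    obtain ⟨j, rfl⟩ := hi2.two_dvd
    obtain ⟨m, rfl⟩ : ∃ m, n = m + 2 * j := ⟨n - 2 * j, by omega⟩
    rw [expSqCoeff, if_pos hi2, Nat.mul_div_cancel_left _ two_pos, Nat.add_sub_cancel,
      hR.laplacian_pow_kerPoly hφ, eval_smul_of_isHomogeneous (hφ.kerPoly_isHomogeneous m w),
      smul_eval, pow_add, pow_mul, neg_pow]
    norm_num
    field_simp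

theorem hasSum_expSqCoeff (x : ℂ) : HasSum (expSqCoeff x) (Complex.exp x) := by
  have h := NormedSpace.expSeries_div_hasSum_exp (𝔸 := ℂ) x
  rw [← Complex.exp_eq_exp_ℂ] at h
  have hinj : Function.Injective fun j : ℕ => 2 * j := mul_right_injective₀ two_ne_zero
  have hcomp : (expSqCoeff x ∘ fun j => 2 * j) = fun j => x ^ j / (j.factorial : ℂ) := by
    ext j
    simp [expSqCoeff]
  rw [← hinj.hasSum_iff, hcomp]
  · exact h
  · intro n hn
    rw [expSqCoeff, if_neg]
    rintro ⟨j, rfl⟩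
    exact hn ⟨j, by dsimp only; ring⟩

theorem norm_expSqCoeff_le {x : ℂ} {A : ℝ} (hA : ‖x‖ ≤ A) (n : ℕ) :
    ‖expSqCoeff x n‖ ≤ ‖expSqCoeff A n‖ := by
  have hA0 : 0 ≤ A := (norm_nonneg _).trans hA
  rw [expSqCoeff, expSqCoeff]
  split_ifs
  · simp only [norm_div, norm_pow, Complex.norm_real, Real.norm_of_nonneg hA0]
    gcongr
  · simp

theorem summable_norm_expSqCoeff (x : ℂ) : Summable fun n => ‖expSqCoeff x n‖ :=
  (hasSum_expSqCoeff x).summable.norm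

/-- On bounded sets the series of the homogeneous parts of the exponential kernel is dominated by an
exponential series. -/
theorem IsRootData.norm_eval_kerPoly_le_of_norm_le (hR : IsRootData Rp k)
    (hφ : IsOrthonormalBasis Rp k φ) {B : ℝ} {z w : Fin N → ℂ} (hz : ‖z‖ ≤ B) (hw : ‖w‖ ≤ B)
    (n : ℕ) :
    ‖eval z (kerPoly φ n w)‖ ≤ ((N + 1) * B * (N * B)) ^ n / n.factorial := by
  have hB : 0 ≤ B := (norm_nonneg _).trans hz
  have h1 : ∑ i, ‖z i‖ ^ 2 ≤ ((N + 1) * B) ^ 2 := by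
    calc ∑ i, ‖z i‖ ^ 2 ≤ ∑ _i : Fin N, B ^ 2 := Finset.sum_le_sum fun i _ => by
          gcongr
          exact (norm_le_pi_norm z i).trans hz
      _ = N * B ^ 2 := by simp
      _ ≤ ((N + 1) * B) ^ 2 := by
          rw [mul_pow]
          gcongr
          nlinarith [(Nat.cast_nonneg N : (0 : ℝ) ≤ N)]
  have h2 : ∑ i, ‖w i‖ ≤ N * B := by
    calc ∑ i, ‖w i‖ ≤ ∑ _i : Fin N, B := Finset.sum_le_sum fun i _ =>
          (norm_le_pi_norm w i).trans hw
      _ = N * B := by simp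
  refine (hR.norm_eval_kerPoly_le hφ (by positivity) w n h1).trans ?_
  gcongr

theorem IsRootData.summable_norm_eval_kerPoly (hR : IsRootData Rp k)
    (hφ : IsOrthonormalBasis Rp k φ) (z w : Fin N → ℂ) :
    Summable fun n => ‖eval z (kerPoly φ n w)‖ :=
  Summable.of_nonneg_of_le (fun _ => norm_nonneg _)
    (fun n => hR.norm_eval_kerPoly_le_of_norm_le hφ (le_max_left ‖z‖ ‖w‖) (le_max_right ‖z‖ ‖w‖) n)
    (Real.summable_pow_div_factorial _)

theorem IsRootData.hasSum_hermiteSum (hR : IsRootData Rp k) (hφ : IsOrthonormalBasis Rp k φ)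
    (z w : Fin N → ℂ) :
    HasSum (fun n => hermiteSum Rp k φ n z w)
      (Complex.exp (-∑ i, w i ^ 2) * ∑' n, eval ((2 : ℂ) • z) (kerPoly φ n w)) := by
  have h1 := summable_norm_expSqCoeff (-∑ i, w i ^ 2)
  have h2 := hR.summable_norm_eval_kerPoly hφ ((2 : ℂ) • z) w
  simp only [hR.hermiteSum_eq hφ]
  rw [← (hasSum_expSqCoeff (-∑ i, w i ^ 2)).tsum_eq,
    tsum_mul_tsum_eq_tsum_sum_antidiagonal_of_summable_norm h1 h2]
  exact (summable_norm_sum_mul_antidiagonal_of_summable_norm h1 h2).of_norm.hasSum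

theorem IsRootData.convergesNormally_hermiteSum (hR : IsRootData Rp k)
    (hφ : IsOrthonormalBasis Rp k φ) :
    ConvergesNormally (fun (n : ℕ) (p : (Fin N → ℂ) × (Fin N → ℂ)) =>
      hermiteSum Rp k φ n p.1 p.2) := by
  intro S hS
  obtain ⟨B, hB, hSB⟩ := hS.isBounded.exists_pos_norm_le
  set A : ℝ := N * B ^ 2
  set b : ℕ → ℝ := fun n => ((N + 1) * (2 * B) * (N * (2 * B))) ^ n / n.factorial
  refine ⟨fun n => ∑ p ∈ Finset.HasAntidiagonal.antidiagonal n, ‖expSqCoeff A p.1‖ * b p.2, ?_, ?_⟩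
  · have h1 : Summable fun n => ‖‖expSqCoeff A n‖‖ := by
      simpa using summable_norm_expSqCoeff A
    have h2 : Summable fun n => ‖b n‖ := (Real.summable_pow_div_factorial _).norm
    exact (summable_norm_sum_mul_antidiagonal_of_summable_norm h1 h2).of_norm
  · rintro n ⟨z, w⟩ hp
    have hzB : ‖z‖ ≤ B := (norm_fst_le (z, w)).trans (hSB _ hp)
    have hwB : ‖w‖ ≤ B := (norm_snd_le (z, w)).trans (hSB _ hp)
    dsimp only
    rw [hR.hermiteSum_eq hφ]
    refine (norm_sum_le _ _).trans (Finset.sum_le_sum fun p _ => ?_)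
    rw [norm_mul]
    refine mul_le_mul (norm_expSqCoeff_le ?_ _) ?_ (norm_nonneg _) (norm_nonneg _)
    · rw [norm_neg]
      refine (norm_sum_le _ _).trans ?_
      calc ∑ i, ‖w i ^ 2‖ ≤ ∑ _i : Fin N, B ^ 2 := Finset.sum_le_sum fun i _ => by
            rw [norm_pow]
            gcongr
            exact (norm_le_pi_norm w i).trans hwB
        _ = A := by simp [A]
    · refine hR.norm_eval_kerPoly_le_of_norm_le hφ ?_ (hwB.trans (by linarith)) _
      rw [norm_smul]
      simpa using hzB

/-! ### Normally convergent series of entire functions of several variables -/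

/-- Cauchy's estimate for the derivative of an entire function on a normed space. -/
theorem norm_fderiv_le_of_norm_le {E : Type*} [NormedAddCommGroup E] [NormedSpace ℂ E]
    {f : E → ℂ} (hf : Differentiable ℂ f) {R M : ℝ} (hM : ∀ x, ‖x‖ ≤ R + 1 → ‖f x‖ ≤ M) {x : E}
    (hx : ‖x‖ ≤ R) : ‖fderiv ℂ f x‖ ≤ M := by
  have hM0 : 0 ≤ M := (norm_nonneg _).trans (hM x (by linarith))
  refine ContinuousLinearMap.opNorm_le_bound _ hM0 fun v => ?_
  rcases eq_or_ne v 0 with rfl | hv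
  · simp
  have hv' : 0 < ‖v‖ := norm_pos_iff.2 hv
  have hline : HasDerivAt (fun t : ℂ => x + t • v) v 0 := by
    simpa using ((hasDerivAt_id (0 : ℂ)).smul_const v).const_add x
  have hd : HasDerivAt (fun t : ℂ => f (x + t • v)) (fderiv ℂ f x v) 0 := by
    have h := (hf (x + (0 : ℂ) • v)).hasFDerivAt.comp_hasDerivAt (0 : ℂ) hline
    rwa [zero_smul, add_zero] at h
  have hdiff : Differentiable ℂ fun t : ℂ => f (x + t • v) := by fun_prop
  have h := Complex.norm_deriv_le_of_forall_mem_sphere_norm_le (c := 0) (R := ‖v‖⁻¹) (C := M)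
    (by positivity) hdiff.diffContOnCl fun t ht => hM _ ?_
  · rw [hd.deriv, div_inv_eq_mul] at h
    exact h
  · rw [mem_sphere_zero_iff_norm] at ht
    refine (norm_add_le _ _).trans (add_le_add hx ?_)
    rw [norm_smul, ht, inv_mul_cancel₀ hv'.ne']

theorem hasFDerivAt_tsum_of_norm_le {E : Type*} [NormedAddCommGroup E] [NormedSpace ℂ E]
    {F : ℕ → E → ℂ} (hF : ∀ n, Differentiable ℂ (F n))
    (hB : ∀ R, ∃ u : ℕ → ℝ, Summable u ∧ ∀ n x, ‖x‖ ≤ R → ‖F n x‖ ≤ u n) (x : E) :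
    HasFDerivAt (fun y => ∑' n, F n y) (∑' n, fderiv ℂ (F n) x) x ∧
      Summable fun n => fderiv ℂ (F n) x := by
  obtain ⟨u, hu, hFu⟩ := hB (‖x‖ + 1 + 1)
  have hd : ∀ n y, y ∈ Metric.ball (0 : E) (‖x‖ + 1) → ‖fderiv ℂ (F n) y‖ ≤ u n :=
    fun n y hy => norm_fderiv_le_of_norm_le (hF n) (hFu n) (mem_ball_zero_iff.1 hy).le
  have hx : x ∈ Metric.ball (0 : E) (‖x‖ + 1) := by simp
  refine ⟨hasFDerivAt_tsum_of_isPreconnected hu Metric.isOpen_ball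
    (convex_ball _ _).isPreconnected (fun n y _ => (hF n y).hasFDerivAt) hd hx ?_ hx,
    Summable.of_norm_bounded hu fun n => hd n x hx⟩
  exact Summable.of_norm_bounded hu fun n => hFu n x (by linarith)

/-! ### Dunkl operators on polynomial functions -/

theorem hasFDerivAt_eval (p : Poly N) (z : Fin N → ℂ) :
    HasFDerivAt (fun z : Fin N → ℂ => eval z p)
      (∑ i, eval z (pderiv i p) • (ContinuousLinearMap.proj i : (Fin N → ℂ) →L[ℂ] ℂ)) z := by
  induction p using MvPolynomial.induction_on with
  | C a =>
    simp only [eval_C]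
    refine (hasFDerivAt_const (𝕜 := ℂ) a z).congr_fderiv ?_
    ext v
    simp
  | add p q hp hq =>
    simp only [map_add]
    refine (hp.add hq).congr_fderiv ?_
    ext v
    simp [add_mul, Finset.sum_add_distrib]
  | mul_X p j hp =>
    have h := hp.mul (ContinuousLinearMap.proj (R := ℂ) (φ := fun _ : Fin N => ℂ) j).hasFDerivAt
    simp only [map_mul, eval_X]
    refine h.congr_fderiv ?_
    ext v
    simp only [pderiv_mul, pderiv_X_eq, map_add, map_mul, eval_X, eval_C, mul_ite, mul_one,
      mul_zero]
    simp [Finset.mul_sum, add_mul, Finset.sum_add_distrib]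
    rw [add_comm]
    congr 1
    exact Finset.sum_congr rfl fun i _ => by ring

theorem differentiable_eval (p : Poly N) : Differentiable ℂ fun z : Fin N → ℂ => eval z p :=
  fun z => (hasFDerivAt_eval p z).differentiableAt

/-- The inclusion `toC` of `ℝ^N` in `ℂ^N` as a continuous `ℝ`-linear map. -/
def toCL (N : ℕ) : V N →L[ℝ] (Fin N → ℂ) :=
  ContinuousLinearMap.pi fun i => Complex.ofRealCLM.comp (EuclideanSpace.proj i)

theorem toCL_apply (x : V N) : toCL N x = toC x := by
  ext i
  simp [toCL, toC]

theorem hasFDerivAt_comp_toC {f : (Fin N → ℂ) → ℂ} {f' : (Fin N → ℂ) →L[ℂ] ℂ} {x : V N}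
    (hf : HasFDerivAt f f' (toC x)) :
    HasFDerivAt (fun x => f (toC x)) ((f'.restrictScalars ℝ).comp (toCL N)) x := by
  rw [← toCL_apply] at hf
  have h := (hf.restrictScalars ℝ).comp x (toCL N).hasFDerivAt
  refine h.congr_of_eventuallyEq (Filter.Eventually.of_forall fun y => ?_)
  simp [toCL_apply]

theorem fderiv_eval_toC (p : Poly N) (x v : V N) :
    fderiv ℝ (fun x => eval (toC x) p) x v = ∑ i, (v i : ℂ) * eval (toC x) (pderiv i p) := by
  rw [(hasFDerivAt_comp_toC (hasFDerivAt_eval p (toC x))).fderiv]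
  simp [toCL_apply, toC, mul_comm]

theorem eval_dividedDifference_of_inner_eq_zero {α : V N} (hα : inner ℝ α α = 2) {x : V N}
    (hx : inner ℝ α x = 0) (p : Poly N) :
    eval (toC x) (dividedDifference α p) = ∑ i, (α i : ℂ) * eval (toC x) (pderiv i p) := by
  have hl : eval (toC x) (linForm α) = 0 := by rw [eval_toC_linForm, hx, Complex.ofReal_zero]
  have hfix : cRefl α (toC x) = toC x := by
    ext i
    rw [cRefl, hl, mul_zero, sub_zero]
  set S := ∑ j, (α j : ℂ) * eval (toC x) (pderiv j (reflPoly α p)) with hS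
  have h1 : ∀ i, eval (toC x) (pderiv i p) =
      eval (toC x) (pderiv i (reflPoly α p)) - α i * S := fun i => by
    have h := congrArg (eval (toC x)) (reflPoly_pderiv hα i p)
    rw [eval_reflPoly hα, hfix] at h
    rw [h, hS]
    simp
  have h2 : ∑ i, (α i : ℂ) * eval (toC x) (pderiv i p) = -S := by
    simp only [h1, mul_sub, Finset.sum_sub_distrib, ← hS, ← mul_assoc, ← Finset.sum_mul,
      sum_coord_sq hα]
    ring
  -- Differentiate `p - p ∘ σ_α = ⟨α, ·⟩ q` in direction `α`, where `⟨α, α⟩ = 2`.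
  have h3 : ∑ i, (α i : ℂ) * eval (toC x) (pderiv i (linForm α * dividedDifference α p)) =
      2 * eval (toC x) (dividedDifference α p) := by
    simp only [pderiv_mul, pderiv_linForm, map_add, map_mul, eval_C, hl, zero_mul, add_zero,
      ← mul_assoc, ← Finset.sum_mul, sum_coord_sq hα]
  rw [linForm_mul_dividedDifference hα] at h3
  simp only [map_sub, mul_sub, Finset.sum_sub_distrib, ← hS, h2] at h3
  rw [h2]
  linear_combination -h3 / 2

/-- The Dunkl operators on functions extend those on polynomials. -/
theorem IsRootData.dunklOp_eval (hR : IsRootData Rp k) (i : Fin N) (p : Poly N) (x : V N) :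
    dunklOp Rp k i (fun x => eval (toC x) p) x = eval (toC x) (dunklPoly Rp k i p) := by
  rw [dunklOp, dunklPoly_apply, map_add, map_sum, fderiv_eval_toC]
  congr 1
  · rw [Finset.sum_eq_single i] <;> simp +contextual
  · refine Finset.sum_congr rfl fun α hα => ?_
    have hα2 := hR.inner_self α hα
    rw [map_mul, eval_C]
    congr 1
    split_ifs with h
    · rw [fderiv_eval_toC, eval_dividedDifference_of_inner_eq_zero hα2 h]
    · have h' : ((inner ℝ α x : ℝ) : ℂ) ≠ 0 := by exact_mod_cast h
      rw [div_eq_iff h', ← eval_toC_linForm, mul_comm, ← map_mul,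
        linForm_mul_dividedDifference hα2, map_sub, eval_reflPoly hα2, cRefl_toC hα2]

/-! ### Existence of the generalized exponential kernel -/

/-- The sum `∑ K_n(z, w)` of the homogeneous kernels. -/
def kerSum (φ : Module.Basis (Fin N →₀ ℕ) ℂ (Poly N)) (z w : Fin N → ℂ) : ℂ :=
  ∑' n, eval z (kerPoly φ n w)

theorem differentiable_eval_kerPoly (n : ℕ) :
    Differentiable ℂ fun p : (Fin N → ℂ) × (Fin N → ℂ) => eval p.1 (kerPoly φ n p.2) := by
  simp only [kerPoly, map_sum, smul_eval]
  refine Differentiable.fun_sum fun ν _ => ?_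
  exact ((differentiable_eval _).comp differentiable_snd).mul
    ((differentiable_eval _).comp differentiable_fst)

theorem IsRootData.exists_summable_norm_eval_kerPoly_le (hR : IsRootData Rp k)
    (hφ : IsOrthonormalBasis Rp k φ) (R : ℝ) :
    ∃ u : ℕ → ℝ, Summable u ∧ ∀ n (p : (Fin N → ℂ) × (Fin N → ℂ)), ‖p‖ ≤ R →
      ‖eval p.1 (kerPoly φ n p.2)‖ ≤ u n :=
  ⟨_, Real.summable_pow_div_factorial _, fun n p hp => hR.norm_eval_kerPoly_le_of_norm_le hφ
    ((norm_fst_le p).trans hp) ((norm_snd_le p).trans hp) n⟩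

theorem dunklOp_hasSum {f : V N → ℂ} {g : ℕ → V N → ℂ} {x : V N} (i : Fin N)
    (hf : ∀ x, HasSum (fun n => g n x) (f x))
    (hf' : ∀ v, HasSum (fun n => fderiv ℝ (g n) x v) (fderiv ℝ f x v)) :
    HasSum (fun n => dunklOp Rp k i (g n) x) (dunklOp Rp k i f x) := by
  refine (hf' _).add (hasSum_sum fun α _ => HasSum.mul_left _ ?_)
  split_ifs
  · exact hf' α
  · exact ((hf x).sub (hf _)).div_const _

theorem IsRootData.isDunklKernel_kerSum (hR : IsRootData Rp k) (hφ : IsOrthonormalBasis Rp k φ) :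
    IsDunklKernel Rp k (kerSum φ) := by
  have hD := hasFDerivAt_tsum_of_norm_le (differentiable_eval_kerPoly (φ := φ))
    (hR.exists_summable_norm_eval_kerPoly_le hφ)
  refine ⟨fun p => (hD p).1.differentiableAt, fun y => ⟨?_, fun i x => ?_⟩⟩
  · rw [kerSum, tsum_eq_single 0, hφ.kerPoly_zero, map_one]
    intro n hn
    have h := eval_smul_of_isHomogeneous (hφ.kerPoly_isHomogeneous n (toC y)) 0 0
    rwa [zero_pow hn, zero_mul, smul_zero] at h
  have hsum : ∀ x : V N, HasSum (fun n => eval (toC x) (kerPoly φ n (toC y)))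
      (kerSum φ (toC x) (toC y)) := fun x =>
    (hR.summable_norm_eval_kerPoly hφ _ _).of_norm.hasSum
  obtain ⟨h1, h2⟩ := hD (toC x, toC y)
  have hpair : ∀ {F : (Fin N → ℂ) × (Fin N → ℂ) → ℂ}
      {F' : (Fin N → ℂ) × (Fin N → ℂ) →L[ℂ] ℂ}, HasFDerivAt F F' (toC x, toC y) → ∀ v : V N,
      fderiv ℝ (fun x' => F (toC x', toC y)) x v = F' (toC v, 0) := fun {F F'} hF v => by
    have h := hF.comp (toC x) (hasFDerivAt_prodMk_left (𝕜 := ℂ) (toC x) (toC y))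
    have h' := (hasFDerivAt_comp_toC h).fderiv
    simp only [Function.comp_apply] at h'
    rw [h']
    simp [toCL_apply]
  have hderiv : ∀ v, HasSum
      (fun n => fderiv ℝ (fun x' => eval (toC x') (kerPoly φ n (toC y))) x v)
      (fderiv ℝ (fun x' => kerSum φ (toC x') (toC y)) x v) := fun v => by
    have h3 := (h2.hasSum.mapL (ContinuousLinearMap.apply ℂ ℂ ((toC v, 0) :
      (Fin N → ℂ) × (Fin N → ℂ))))
    have h4 := hpair h1 v
    have h5 : ∀ n, fderiv ℝ (fun x' => eval (toC x') (kerPoly φ n (toC y))) x v =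
        fderiv ℂ (fun p : (Fin N → ℂ) × (Fin N → ℂ) => eval p.1 (kerPoly φ n p.2))
          (toC x, toC y) (toC v, 0) := fun n =>
      hpair (differentiable_eval_kerPoly n (toC x, toC y)).hasFDerivAt v
    simp only [h5]
    rw [show (fun x' => kerSum φ (toC x') (toC y)) = fun x' : V N =>
      ∑' n, eval (toC x') (kerPoly φ n (toC y)) from rfl, h4]
    exact h3
  have hT := dunklOp_hasSum (Rp := Rp) (k := k) i hsum hderiv
  simp only [hR.dunklOp_eval] at hT
  rw [← hasSum_nat_add_iff' 1] at hT
  simp only [hR.dunklPoly_kerPoly hφ, Finset.sum_range_one, hR.dunklPoly_kerPoly_zero hφ, map_zero,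
    sub_zero, smul_eval] at hT
  exact hT.unique ((hsum x).mul_left _)

/-! ### Uniqueness of the generalized exponential kernel -/

/-- The Dunkl analogue of the Euler operator on functions. -/
theorem IsRootData.sum_mul_dunklOp (hR : IsRootData Rp k) (f : V N → ℂ) (x : V N) :
    ∑ i, (x i : ℂ) * dunklOp Rp k i f x =
      fderiv ℝ f x x + ∑ α ∈ Rp, (k α : ℂ) * (f x - f (refl α x)) := by
  have hx : ∑ i, (x i : ℂ) * fderiv ℝ f x (EuclideanSpace.single i 1) = fderiv ℝ f x x := by
    have hb := congrArg (fderiv ℝ f x) ((EuclideanSpace.basisFun (Fin N) ℝ).sum_repr x)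
    simp only [map_sum, map_smul, EuclideanSpace.basisFun_repr, EuclideanSpace.basisFun_apply,
      Complex.real_smul] at hb
    exact hb
  simp only [dunklOp, mul_add, Finset.sum_add_distrib, hx]
  congr 1
  simp only [Finset.mul_sum]
  rw [Finset.sum_comm]
  refine Finset.sum_congr rfl fun α hα => ?_
  have h : ∑ i, (x i : ℂ) * ((k α * α i : ℝ) : ℂ) = (k α : ℂ) * ((inner ℝ α x : ℝ) : ℂ) := by
    rw [inner_eq_sum]
    push_cast
    rw [Finset.mul_sum]
    exact Finset.sum_congr rfl fun i _ => by ring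
  simp only [← mul_assoc, ← Finset.sum_mul, h]
  split_ifs with h0
  · rw [h0, refl_apply (hR.inner_self α hα), h0]
    simp
  · have h' : ((inner ℝ α x : ℝ) : ℂ) ≠ 0 := by exact_mod_cast h0
    field_simp

/-- A joint eigenfunction of the Dunkl operators is determined by its value at the origin. Let
`|g|² exp (-2 c |x|)`, where `c > |y|`, attain its maximum over a ball at `x₀`. Then the radial
derivative there is non-negative, and `|g ∘ σ_α| ≤ |g|` at `x₀`; by the Euler identity for `g` and
`k ≥ 0` the radial derivative is negative unless `g x₀ = 0`. -/
theorem IsRootData.eq_zero_of_dunklOp_eq (hR : IsRootData Rp k) {g : V N → ℂ}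
    (hg : Differentiable ℝ g) (hg0 : g 0 = 0) (y : V N)
    (hT : ∀ i x, dunklOp Rp k i g x = ((y i : ℝ) : ℂ) * g x) (x : V N) : g x = 0 := by
  set c := ‖y‖ + 1 with hc
  set Φ : V N → ℝ := fun x => ‖g x‖ ^ 2 * Real.exp (-(2 * c * ‖x‖)) with hΦ
  have hΦc : Continuous Φ := by
    have := hg.continuous
    fun_prop
  have hΦ0 : ∀ x, Φ x ≤ 0 → g x = 0 := fun x h => by
    have h1 : ‖g x‖ ^ 2 ≤ 0 := nonpos_of_mul_nonpos_left h (Real.exp_pos _)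
    simpa using le_antisymm h1 (sq_nonneg _)
  obtain ⟨x₀, hx₀, hmax⟩ := (isCompact_closedBall (0 : V N) ‖x‖).exists_isMaxOn
    ⟨x, by simp⟩ hΦc.continuousOn
  have hmax' : ∀ v, ‖v‖ ≤ ‖x‖ → Φ v ≤ Φ x₀ := fun v hv => hmax (by simpa using hv)
  have hx₀' : ‖x₀‖ ≤ ‖x‖ := by simpa using hx₀
  suffices g x₀ = 0 from hΦ0 x ((hmax' x le_rfl).trans (by simp [hΦ, this]))
  rcases eq_or_ne x₀ 0 with rfl | hne
  · exact hg0
  have hpos : 0 < ‖x₀‖ := norm_pos_iff.2 hne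
  have hrefl : ∀ α, ‖g (refl α x₀)‖ ≤ ‖g x₀‖ := fun α => by
    have h := hmax' (refl α x₀) (by rwa [LinearIsometryEquiv.norm_map])
    simp only [hΦ, LinearIsometryEquiv.norm_map] at h
    exact (sq_le_sq₀ (norm_nonneg _) (norm_nonneg _)).1 (le_of_mul_le_mul_right h (Real.exp_pos _))
  have heuler : fderiv ℝ g x₀ x₀ =
      inner ℝ x₀ y • g x₀ - ∑ α ∈ Rp, k α • (g x₀ - g (refl α x₀)) := by
    have h := hR.sum_mul_dunklOp g x₀
    simp only [hT, ← mul_assoc, ← Finset.sum_mul] at h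
    simp only [Complex.real_smul, inner_eq_sum, Complex.ofReal_sum, Complex.ofReal_mul]
    linear_combination -h
  have hre : inner ℝ (g x₀) (fderiv ℝ g x₀ x₀) ≤ ‖x₀‖ * ‖y‖ * ‖g x₀‖ ^ 2 := by
    rw [heuler, inner_sub_right, inner_smul_right, inner_sum, real_inner_self_eq_norm_sq]
    have h1 : 0 ≤ ∑ α ∈ Rp, inner ℝ (g x₀) (k α • (g x₀ - g (refl α x₀))) :=
      Finset.sum_nonneg fun α hα => by
        rw [inner_smul_right, inner_sub_right, real_inner_self_eq_norm_sq]
        refine mul_nonneg (hR.nonneg α hα) (sub_nonneg.2 ((real_inner_le_norm _ _).trans ?_))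
        rw [pow_two]
        exact mul_le_mul_of_nonneg_left (hrefl α) (norm_nonneg _)
    have h2 := mul_le_mul_of_nonneg_right (real_inner_le_norm x₀ y) (sq_nonneg ‖g x₀‖)
    linarith
  set e := Real.exp (-(2 * c * ‖x₀‖)) with he
  have hline : HasDerivAt (fun t : ℝ => t • x₀) x₀ 1 := by
    simpa using (hasDerivAt_id (1 : ℝ)).smul_const x₀
  have hgd : HasDerivAt (fun t : ℝ => g (t • x₀)) (fderiv ℝ g x₀ x₀) 1 := by
    have h := (hg ((1 : ℝ) • x₀)).hasFDerivAt.comp_hasDerivAt (1 : ℝ) hline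
    rwa [one_smul] at h
  have hed : HasDerivAt (fun t : ℝ => Real.exp (-(2 * c * (t * ‖x₀‖))))
      (e * -(2 * c * ‖x₀‖)) 1 := by
    have h := ((((hasDerivAt_id (1 : ℝ)).mul_const ‖x₀‖).const_mul (2 * c)).neg).exp
    simpa [he] using h
  have hd := hgd.norm_sq.mul hed
  have hmax1 : IsLocalMaxOn (fun t : ℝ => ‖g (t • x₀)‖ ^ 2 * Real.exp (-(2 * c * (t * ‖x₀‖))))
      (Set.Icc 0 1) 1 := by
    refine IsMaxOn.localize fun t ht => ?_
    have h := hmax' (t • x₀) (by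
      rw [norm_smul, Real.norm_of_nonneg ht.1]
      exact (mul_le_of_le_one_left hpos.le ht.2).trans hx₀')
    simpa [hΦ, norm_smul, abs_of_nonneg ht.1] using h
  -- `x₀` may lie on the sphere, so only the derivative in the inward direction has a sign.
  have hdir := hmax1.hasFDerivWithinAt_nonpos hd.hasFDerivAt.hasFDerivWithinAt
    (y := -1) (mem_posTangentConeAt_of_segment_subset (by
      rw [show (1 : ℝ) + -1 = 0 by norm_num, segment_symm, segment_eq_Icc zero_le_one]))
  simp only [one_smul, one_mul, ContinuousLinearMap.toSpanSingleton_apply, smul_eq_mul,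
    ← he] at hdir
  have he0 : 0 < e := Real.exp_pos _
  have h3 : ‖x₀‖ * ‖g x₀‖ ^ 2 * e ≤ 0 := by
    have h4 := mul_le_mul_of_nonneg_right hre he0.le
    rw [hc] at hdir
    nlinarith
  have h5 : ‖g x₀‖ ^ 2 ≤ 0 :=
    nonpos_of_mul_nonpos_right (nonpos_of_mul_nonpos_left h3 he0) hpos
  simpa using le_antisymm h5 (sq_nonneg _)

/-- An entire function on `ℂ^N × ℂ^N` which vanishes on `ℝ^N × ℝ^N` is zero: restrict it to the
complex line `λ ↦ Re p + λ Im p` and apply the identity theorem in one variable. -/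
theorem eq_zero_of_forall_toC {F : (Fin N → ℂ) × (Fin N → ℂ) → ℂ} (hF : Differentiable ℂ F)
    (h0 : ∀ x y : V N, F (toC x, toC y) = 0) (p : (Fin N → ℂ) × (Fin N → ℂ)) : F p = 0 := by
  let re : (Fin N → ℂ) → V N := fun z => WithLp.toLp 2 fun i => (z i).re
  let im : (Fin N → ℂ) → V N := fun z => WithLp.toLp 2 fun i => (z i).im
  have hz : ∀ z, toC (re z) + Complex.I • toC (im z) = z := fun z => by
    ext i
    simp [toC, re, im, mul_comm Complex.I, Complex.re_add_im]
  let L : ℂ → ℂ := fun t => F (toC (re p.1) + t • toC (im p.1), toC (re p.2) + t • toC (im p.2))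
  have hL : Differentiable ℂ L := hF.comp (by fun_prop)
  have hreal : ∀ t : ℝ, L t = 0 := fun t => by
    have h : ∀ z, toC (re z) + (t : ℂ) • toC (im z) = toC (re z + t • im z) := fun z => by
      ext i
      simp [toC]
    simp only [L, h, h0]
  have htend : Filter.Tendsto (fun t : ℝ => (t : ℂ)) (nhdsWithin 0 {0}ᶜ) (nhdsWithin 0 {0}ᶜ) := by
    refine tendsto_nhdsWithin_iff.2 ⟨?_, ?_⟩
    · exact (Complex.continuous_ofReal.tendsto' 0 0 Complex.ofReal_zero).mono_left
        nhdsWithin_le_nhds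
    · filter_upwards [self_mem_nhdsWithin] with t ht
      simpa using ht
  have hfreq : ∃ᶠ t in nhdsWithin (0 : ℂ) {0}ᶜ, L t = 0 :=
    htend.frequently (Filter.Frequently.of_forall hreal)
  have hzero := AnalyticOnNhd.eqOn_zero_of_preconnected_of_frequently_eq_zero
    (f := L) (U := Set.univ) (fun t _ => hL.analyticAt t) isPreconnected_univ (Set.mem_univ 0)
    hfreq (Set.mem_univ Complex.I)
  simpa only [L, hz, Pi.zero_apply] using hzero

theorem IsRootData.isDunklKernel_unique (hR : IsRootData Rp k)
    {K K' : (Fin N → ℂ) → (Fin N → ℂ) → ℂ} (hK : IsDunklKernel Rp k K)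
    (hK' : IsDunklKernel Rp k K') : K = K' := by
  have hdiff : ∀ {K : (Fin N → ℂ) → (Fin N → ℂ) → ℂ}, IsDunklKernel Rp k K → ∀ y : V N,
      Differentiable ℝ fun x => K (toC x) (toC y) := fun {K} hK y x => by
    have h : Differentiable ℂ fun z => K z (toC y) :=
      hK.1.comp (differentiable_id.prodMk (differentiable_const (toC y)))
    exact (hasFDerivAt_comp_toC (h (toC x)).hasFDerivAt).differentiableAt
  have hreal : ∀ x y : V N, K (toC x) (toC y) - K' (toC x) (toC y) = 0 := fun x y => by
    refine hR.eq_zero_of_dunklOp_eq (g := fun x => K (toC x) (toC y) - K' (toC x) (toC y))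
      ((hdiff hK y).sub (hdiff hK' y)) ?_ y (fun i x => ?_) x
    · have h0 : toC (0 : V N) = 0 := by
        ext i
        simp [toC]
      simp only [h0, (hK.2 y).1, (hK'.2 y).1, sub_self]
    · rw [mul_sub, ← (hK.2 y).2 i x, ← (hK'.2 y).2 i x]
      simp only [dunklOp]
      rw [fderiv_fun_sub (hdiff hK y x) (hdiff hK' y x)]
      rw [add_sub_add_comm, ← Finset.sum_sub_distrib]
      congr 1
      refine Finset.sum_congr rfl fun α _ => ?_
      rw [← mul_sub]
      congr 1
      split_ifs
      · rfl
      · ring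
  ext z w
  exact sub_eq_zero.1 (eq_zero_of_forall_toC (hK.1.sub hK'.1) hreal (z, w))

end Dunkl

end

theorem proposition3p8 (N : ℕ)
    (G : Subgroup (Dunkl.V N ≃ₗᵢ[ℝ] Dunkl.V N)) (hG : Dunkl.IsFiniteReflectionGroup G)
    (Rp : Finset (Dunkl.V N)) (hRp : Dunkl.IsPositiveSubsystem G Rp)
    (k : Dunkl.V N → ℝ) (hk : Dunkl.IsMultiplicity G k)
    (φ : Module.Basis (Fin N →₀ ℕ) ℂ (Dunkl.Poly N)) (hφ : Dunkl.IsOrthonormalBasis Rp k φ) :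
    (∃! K, Dunkl.IsDunklKernel Rp k K) ∧
    Dunkl.ConvergesNormally
      (fun (n : ℕ) (p : (Fin N → ℂ) × (Fin N → ℂ)) => Dunkl.hermiteSum Rp k φ n p.1 p.2) ∧
    ∀ z w : Fin N → ℂ,
      HasSum (fun n : ℕ => Dunkl.hermiteSum Rp k φ n z w)
        (Complex.exp (-∑ i, w i ^ 2) * Dunkl.dunklKernel Rp k ((2 : ℂ) • z) w) := by
  have hR := Dunkl.isRootData hRp hk
  have hK := hR.isDunklKernel_kerSum hφ
  have hex : ∃! K, Dunkl.IsDunklKernel Rp k K :=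
    ⟨_, hK, fun K' hK' => hR.isDunklKernel_unique hK' hK⟩
  refine ⟨hex, hR.convergesNormally_hermiteSum hφ, fun z w => ?_⟩
  have heq : Dunkl.dunklKernel Rp k = Dunkl.kerSum φ :=
    hex.unique (Classical.epsilon_spec hex.exists) hK
  rw [heq]
  exact hR.hasSum_hermiteSum hφ z w
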